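/- Let $\mathbb H^2_+(\mathbb R)\subset L^2(\mathbb R)$ be the Hardy space of functions analytic in the upper half-plane, identified with their boundary values. A bounded operator $\mathbf H$ in $\mathbb H^2_+(\mathbb R)$ is called the Hankel operator with symbol $\varphi\in L^\infty(\mathbb R)$ if $$(\mathbf H w,w)=\int_{\mathbb R}\varphi(\lambda)\,w(-\lambda)\,\overline{w(\lambda)}\,d\lambda\qquad\text{for all } w\in\mathbb H^2_+(\mathbb R).$$ **Theorem.** Let $\mathbf H$ be a self-adjoint Hankel operator in $\mathbb H^2_+(\mathbb R)$ whose symbol is $$\varphi(z)=\sum_{m=1}^M Q_m(z)\,(\alpha_m-iz)^{-K_m-1},$$ where $M\ge 0$, the numbers $\alpha_m\in\mathbb C$ are pairwise distinct with $\operatorname{Re}\alpha_m>0$, $K_m\in\{0,1,2,\dots\}$, and the $Q_m$ are polynomials with complex coefficients such that $\deg Q_m\le K_m$ and $Q_m(-i\alpha_m)\ne 0$. Then for every $m$ with $\operatorname{Im}\alpha_m=0$ the number $\mathsf p_m:=Q_m(-i\alpha_m)$ is real. For such $m$ set $$\mathcal N_+^{(m)}=\mathcal N_-^{(m)}=\frac{K_m+1}{2}\quad\text{if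 } K_m \text{ is odd},$$ $$\mathcal N_+^{(m)}-1=\mathcal N_-^{(m)}=\frac{K_m}{2}\quad\text{if } K_m\text{ is even and }\mathsf p_m>0,$$ $$\mathcal N_+^{(m)}=\mathcal N_-^{(m)}-1=\frac{K_m}{2}\quad\text{if } K_m\text{ is even and }\mathsf p_m<0.$$ Let $M_1$ be the number of indices $m$ with $\operatorname{Im}\alpha_m>0$. Then the total numbers $N_\pm(\mathbf H)$ of (strictly) positive and negative eigenvalues of $\mathbf H$, counted with multiplicity, are $$N_\pm(\mathbf H)=\sum_{m:\ \operatorname{Im}\alpha_m=0}\mathcal N_\pm^{(m)}+\sum_{m:\ \operatorname{Im}\alpha_m>0}K_m+M_1 .$$ -/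

import Mathlib

open MeasureTheory Filter Topology Polynomial
open scoped ENNReal NNReal

/-- `F` is analytic in the open upper half-plane, belongs to the Hardy class `H²` there
(the `L²`-norms over the horizontal lines `Im z = y`, `y > 0`, are uniformly bounded), and has
boundary value `w ∈ L²(ℝ)` on the real line, attained in the `L²`-sense as `y → 0+`. -/
structure IsHardyExtension (w : Lp ℂ 2 (volume : Measure ℝ)) (F : ℂ → ℂ) : Prop where
  analytic : DifferentiableOn ℂ F {z : ℂ | 0 < z.im}
  bounded : ∃ C : ℝ≥0, ∀ y : ℝ, 0 < y →
    eLpNorm (fun x : ℝ => F ((x : ℂ) + (y : ℂ) * Complex.I)) 2 volume ≤ C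
  boundary : Tendsto
    (fun y : ℝ => eLpNorm (fun x : ℝ => F ((x : ℂ) + (y : ℂ) * Complex.I) - w x) 2 volume)
    (𝓝[>] 0) (𝓝 0)

theorem aestronglyMeasurable_line {F : ℂ → ℂ}
    (hF : DifferentiableOn ℂ F {z : ℂ | 0 < z.im}) {y : ℝ} (hy : 0 < y) :
    AEStronglyMeasurable (fun x : ℝ => F ((x : ℂ) + (y : ℂ) * Complex.I)) volume := by
  refine Continuous.aestronglyMeasurable ?_
  refine hF.continuousOn.comp_continuous (by fun_prop) ?_
  intro x
  simpa using hy

theorem IsHardyExtension.add {w v : Lp ℂ 2 (volume : Measure ℝ)} {F G : ℂ → ℂ}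
    (hF : IsHardyExtension w F) (hG : IsHardyExtension v G) :
    IsHardyExtension (w + v) (F + G) := by
  refine ⟨hF.analytic.add hG.analytic, ?_, ?_⟩
  · obtain ⟨C, hC⟩ := hF.bounded
    obtain ⟨D, hD⟩ := hG.bounded
    refine ⟨C + D, fun y hy => ?_⟩
    refine (eLpNorm_add_le (aestronglyMeasurable_line hF.analytic hy)
      (aestronglyMeasurable_line hG.analytic hy) (by norm_num)).trans ?_
    push_cast
    exact add_le_add (hC y hy) (hD y hy)
  · have hlim := hF.boundary.add hG.boundary
    rw [add_zero] at hlim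
    refine tendsto_of_tendsto_of_tendsto_of_le_of_le' tendsto_const_nhds hlim
      (Eventually.of_forall fun _ => zero_le) ?_
    filter_upwards [self_mem_nhdsWithin] with y hy
    have hy' : 0 < y := hy
    refine le_trans (le_of_eq ?_) (eLpNorm_add_le
      ((aestronglyMeasurable_line hF.analytic hy').sub (Lp.aestronglyMeasurable w))
      ((aestronglyMeasurable_line hG.analytic hy').sub (Lp.aestronglyMeasurable v)) (by norm_num))
    refine eLpNorm_congr_ae ?_
    filter_upwards [Lp.coeFn_add w v] with x hx
    simp only [Pi.add_apply, hx]
    ring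

theorem IsHardyExtension.smul (c : ℂ) {w : Lp ℂ 2 (volume : Measure ℝ)} {F : ℂ → ℂ}
    (hF : IsHardyExtension w F) : IsHardyExtension (c • w) (c • F) := by
  refine ⟨hF.analytic.const_smul c, ?_, ?_⟩
  · obtain ⟨C, hC⟩ := hF.bounded
    refine ⟨‖c‖₊ * C, fun y hy => ?_⟩
    refine (eLpNorm_const_smul_le (c := c)
      (f := fun x : ℝ => F ((x : ℂ) + (y : ℂ) * Complex.I))).trans ?_
    push_cast
    exact mul_le_mul_right (hC y hy) _
  · have hlim := ENNReal.Tendsto.const_mul (a := (‖c‖ₑ)) hF.boundary (Or.inr (by simp))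
    rw [mul_zero] at hlim
    refine hlim.congr fun y => ?_
    rw [← eLpNorm_const_smul]
    refine eLpNorm_congr_ae ?_
    filter_upwards [Lp.coeFn_smul c w] with x hx
    simp only [Pi.smul_apply, hx, smul_sub]

/-- The Hardy space `H²₊(ℝ)` of the upper half-plane, as a subspace of `L²(ℝ)` (a function in
the Hardy class is identified with its boundary value). -/
noncomputable def hardyPlus : Submodule ℂ (Lp ℂ 2 (volume : Measure ℝ)) where
  carrier := {w | ∃ F : ℂ → ℂ, IsHardyExtension w F}
  zero_mem' := by
    refine ⟨0, differentiableOn_const 0, ⟨0, fun y _ => by simp⟩, ?_⟩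
    refine tendsto_const_nhds.congr fun y => ?_
    rw [eq_comm, ← eLpNorm_zero (ε := ℂ) (p := 2) (μ := (volume : Measure ℝ))]
    refine eLpNorm_congr_ae ?_
    filter_upwards [Lp.coeFn_zero ℂ 2 (volume : Measure ℝ)] with x _
    simp
  add_mem' := by
    rintro w v ⟨F, hF⟩ ⟨G, hG⟩
    exact ⟨F + G, hF.add hG⟩
  smul_mem' := by
    rintro c w ⟨F, hF⟩
    exact ⟨c • F, hF.smul c⟩

/-- `H` is the Hankel operator in `H²₊(ℝ)` with symbol `φ ∈ L^∞(ℝ)`: its quadratic form is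
`(H w, w) = ∫ φ(x) w(-x) conj(w(x)) dx`. Mathlib's inner product is linear in the second
argument, so `(H w, w)` is `inner ℂ w (H w)`. -/
structure IsHankelWithSymbol (φ : ℝ → ℂ) (H : hardyPlus →L[ℂ] hardyPlus) : Prop where
  symbol_bounded : MemLp φ ∞ (volume : Measure ℝ)
  form_eq : ∀ w : hardyPlus, inner ℂ w (H w) =
    ∫ x : ℝ, φ x * (w : Lp ℂ 2 (volume : Measure ℝ)) (-x) *
      starRingEnd ℂ ((w : Lp ℂ 2 (volume : Measure ℝ)) x)

/-- The rational function `∑ₘ Qₘ(x) (αₘ - i x)^{-Kₘ-1}`, for real `x`. -/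
noncomputable def rationalSymbol {M : ℕ} (α : Fin M → ℂ) (K : Fin M → ℕ) (Q : Fin M → ℂ[X])
    (x : ℝ) : ℂ :=
  ∑ m, (Q m).eval (x : ℂ) / (α m - Complex.I * (x : ℂ)) ^ (K m + 1)

/-- The number of eigenvalues of `T` lying in the set `S` of real numbers, each eigenvalue
counted with its multiplicity. -/
noncomputable def eigenvalueCount {E : Type*} [AddCommGroup E] [Module ℂ E]
    (T : Module.End ℂ E) (S : Set ℝ) : ℕ∞ :=
  ∑' μ : S, Cardinal.toENat (Module.rank ℂ (Module.End.eigenspace T ((μ : ℝ) : ℂ)))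

/-- The number `N₊` of positive eigenvalues, with multiplicity. -/
noncomputable def numPosEigenvalues {E : Type*} [AddCommGroup E] [Module ℂ E]
    (T : Module.End ℂ E) : ℕ∞ := eigenvalueCount T (Set.Ioi 0)

/-- The number `N₋` of negative eigenvalues, with multiplicity. -/
noncomputable def numNegEigenvalues {E : Type*} [AddCommGroup E] [Module ℂ E]
    (T : Module.End ℂ E) : ℕ∞ := eigenvalueCount T (Set.Iio 0)

/-- The contribution of a real term to `N₊`: it is `(K + 1) / 2` if `K` is odd, `K / 2 + 1` if `K`
is even and `p > 0`, and `K / 2` if `K` is even and `p < 0`. -/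
noncomputable def realTermPos (K : ℕ) (p : ℝ) : ℕ :=
  if Odd K then (K + 1) / 2 else if 0 < p then K / 2 + 1 else K / 2

/-- The contribution of a real term to `N₋`: it is `(K + 1) / 2` if `K` is odd, `K / 2` if `K`
is even and `p > 0`, and `K / 2 + 1` if `K` is even and `p < 0`. -/
noncomputable def realTermNeg (K : ℕ) (p : ℝ) : ℕ :=
  if Odd K then (K + 1) / 2 else if p < 0 then K / 2 + 1 else K / 2

open Complex (I)
open scoped ComplexConjugate

/-!
By polarization `(Hw, v) = B(w, Rv)`, where `B(w, u) = ∫ φ(-x) w(x) u(x) dx` and `R` is the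
antilinear involution `w(x) ↦ conj w(-x)`. The function `φ(-x)` is meromorphic in the upper
half-plane with a pole of order `Kₘ + 1` at `aₘ = iαₘ`, so by Cauchy's formula `B(bw, u)` depends
only on values at the `aₘ` once `b` is a finite product of factors `(z - aₘ) / (z + i)` whose order
at each `aₘ` is at least `Kₘ`. In particular, `ker H = b H²₊` for the product `b` with orders
`Kₘ + 1`, and `H` has rank `∑ (Kₘ + 1)`.

If `H` is self-adjoint, the poles are symmetric about the imaginary axis. Elements `w = bv` of `H²₊`
with zeros of order `Kₘ + 1` at the poles to the left of the axis and of about half that order at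
the poles on the axis form a subspace on which the form of `H` is `∑ cₘ |v(aₘ)|²`, where `m` runs
over the poles of odd order on the axis. The two ways of rounding half an odd order either remove
the `m`-th term or keep it, so for either sign one can keep only the terms of that sign. The
resulting semidefinite subspaces have codimensions adding up to the rank of `H`, and hence equal to
the numbers of eigenvalues of either sign.
-/

/-- The Hardy class `H^p` of the upper half-plane at the level of functions: `F` is analytic,
uniformly `L^p`-bounded on horizontal lines, with `L^p`-boundary value `f`. For `p = 2` this is
`IsHardyExtension`, without passing to a class in `Lp`. -/
structure IsHardyFun (p : ℝ≥0∞) (f : ℝ → ℂ) (F : ℂ → ℂ) : Prop where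
  aestronglyMeasurable : AEStronglyMeasurable f
  analytic : DifferentiableOn ℂ F {z : ℂ | 0 < z.im}
  bounded : ∃ C : ℝ≥0, ∀ y : ℝ, 0 < y → eLpNorm (fun x : ℝ => F (x + y * I)) p ≤ C
  boundary : Tendsto (fun y : ℝ => eLpNorm (fun x : ℝ => F (x + y * I) - f x) p) (𝓝[>] 0) (𝓝 0)

theorem IsHardyExtension.isHardyFun {w : Lp ℂ 2 (volume : Measure ℝ)} {F : ℂ → ℂ}
    (h : IsHardyExtension w F) : IsHardyFun 2 w F :=
  ⟨Lp.aestronglyMeasurable w, h.analytic, h.bounded, h.boundary⟩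

theorem add_mul_I_im (x y : ℝ) : ((x : ℂ) + y * I).im = y := by simp

theorem neg_conj_add_mul_I (x y : ℝ) : -conj ((x : ℂ) + y * I) = (-x : ℝ) + y * I := by
  simp only [map_add, map_mul, Complex.conj_ofReal, Complex.conj_I]
  push_cast
  ring

namespace IsHardyFun

variable {p q r : ℝ≥0∞} {f g : ℝ → ℂ} {F G : ℂ → ℂ}

theorem congr_ae (h : IsHardyFun p f F) (hfg : f =ᵐ[volume] g) : IsHardyFun p g F where
  aestronglyMeasurable := h.aestronglyMeasurable.congr hfg
  analytic := h.analytic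
  bounded := h.bounded
  boundary := h.boundary.congr fun y => eLpNorm_congr_ae <| by
    filter_upwards [hfg] with x hx
    rw [hx]

theorem memLp_line (h : IsHardyFun p f F) {y : ℝ} (hy : 0 < y) :
    MemLp (fun x : ℝ => F (x + y * I)) p :=
  let ⟨_, hC⟩ := h.bounded
  ⟨aestronglyMeasurable_line h.analytic hy, (hC y hy).trans_lt ENNReal.coe_lt_top⟩

theorem memLp (h : IsHardyFun p f F) : MemLp f p := by
  obtain ⟨y, hyf, hy⟩ :=
    ((h.boundary.eventually_lt_const ENNReal.zero_lt_top).and self_mem_nhdsWithin).exists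
  have hline := h.memLp_line hy
  have hdiff : MemLp (fun x : ℝ => F (x + y * I) - f x) p :=
    ⟨hline.1.sub h.aestronglyMeasurable, hyf⟩
  refine (hline.sub hdiff).ae_eq (.of_forall fun x => ?_)
  simp

theorem add (hF : IsHardyFun p f F) (hG : IsHardyFun p g G) (hp : 1 ≤ p) :
    IsHardyFun p (fun x => f x + g x) (fun z => F z + G z) where
  aestronglyMeasurable := hF.aestronglyMeasurable.add hG.aestronglyMeasurable
  analytic := hF.analytic.add hG.analytic
  bounded := by
    obtain ⟨C, hC⟩ := hF.bounded
    obtain ⟨D, hD⟩ := hG.bounded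
    refine ⟨C + D, fun y hy => ?_⟩
    push_cast
    exact (eLpNorm_add_le (hF.memLp_line hy).1 (hG.memLp_line hy).1 hp).trans
      (add_le_add (hC y hy) (hD y hy))
  boundary := by
    have hlim := hF.boundary.add hG.boundary
    rw [add_zero] at hlim
    refine tendsto_of_tendsto_of_tendsto_of_le_of_le' tendsto_const_nhds hlim
      (.of_forall fun _ => zero_le) ?_
    filter_upwards [self_mem_nhdsWithin] with y hy
    refine le_trans (le_of_eq ?_) (eLpNorm_add_le
      ((hF.memLp_line hy).1.sub hF.aestronglyMeasurable)
      ((hG.memLp_line hy).1.sub hG.aestronglyMeasurable) hp)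
    exact congrArg (eLpNorm · p volume) (funext fun x => add_sub_add_comm ..)

theorem tendsto_boundary_of_le (h : IsHardyFun p f F) (hp : 1 ≤ p) {A : ℝ → ℝ → ℂ} {c L : ℝ≥0}
    (hA : ∀ᶠ y in 𝓝[>] (0 : ℝ), ∀ x : ℝ,
      ‖A y x‖ ≤ c * ‖F (x + y * I) - f x‖ + L * y * ‖f x‖) :
    Tendsto (fun y => eLpNorm (A y) p) (𝓝[>] 0) (𝓝 0) := by
  have hscale : Tendsto (fun y : ℝ => ‖L * y‖ₑ) (𝓝[>] 0) (𝓝 0) := by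
    have hcont : Continuous fun y : ℝ => ‖L * y‖ₑ := by fun_prop
    simpa using (hcont.tendsto 0).mono_left nhdsWithin_le_nhds
  have hlim : Tendsto (fun y : ℝ => ‖(c : ℝ)‖ₑ * eLpNorm (fun x : ℝ => F (x + y * I) - f x) p +
      ‖L * y‖ₑ * eLpNorm f p) (𝓝[>] 0) (𝓝 0) := by
    simpa only [mul_zero, zero_mul, add_zero] using
      (ENNReal.Tendsto.const_mul h.boundary (.inr (by simp))).add
        (ENNReal.Tendsto.mul_const hscale (.inr h.memLp.2.ne))
  refine tendsto_of_tendsto_of_tendsto_of_le_of_le' tendsto_const_nhds hlim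
    (.of_forall fun _ => zero_le) ?_
  filter_upwards [self_mem_nhdsWithin, hA] with y hy hAy
  have hdiff : AEStronglyMeasurable fun x : ℝ => ‖F (x + y * I) - f x‖ :=
    ((h.memLp_line hy).1.sub h.aestronglyMeasurable).norm
  rw [← eLpNorm_norm f, ← eLpNorm_norm fun x : ℝ => F (x + y * I) - f x, ← eLpNorm_const_smul,
    ← eLpNorm_const_smul]
  exact (eLpNorm_mono_real hAy).trans
    (eLpNorm_add_le (hdiff.const_mul _) (h.aestronglyMeasurable.norm.const_mul _) hp)

theorem mul [p.HolderTriple q r] (hr : 1 ≤ r) (hF : IsHardyFun p f F) (hG : IsHardyFun q g G) :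
    IsHardyFun r (fun x => f x * g x) (fun z => F z * G z) := by
  have holder {u v : ℝ → ℂ} (hu : AEStronglyMeasurable u) (hv : AEStronglyMeasurable v) :
      eLpNorm (fun x => u x * v x) r ≤ eLpNorm u p * eLpNorm v q := by
    have hsmul := eLpNorm_smul_le_mul_eLpNorm (p := p) (q := q) (r := r) hv hu
    exact hsmul
  obtain ⟨C, hC⟩ := hF.bounded
  obtain ⟨D, hD⟩ := hG.bounded
  refine ⟨hF.aestronglyMeasurable.mul hG.aestronglyMeasurable, hF.analytic.mul hG.analytic,
    ⟨C * D, fun y hy => ?_⟩, ?_⟩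
  · push_cast
    exact (holder (hF.memLp_line hy).1 (hG.memLp_line hy).1).trans (mul_le_mul' (hC y hy) (hD y hy))
  · have hlim := (ENNReal.Tendsto.mul_const (b := (D : ℝ≥0∞)) hF.boundary (.inr (by simp))).add
      (ENNReal.Tendsto.const_mul hG.boundary (.inr hF.memLp.2.ne))
    rw [zero_mul, mul_zero, add_zero] at hlim
    refine tendsto_of_tendsto_of_tendsto_of_le_of_le' tendsto_const_nhds hlim
      (.of_forall fun _ => zero_le) ?_
    filter_upwards [self_mem_nhdsWithin] with y hy
    have hFy := (hF.memLp_line hy).1.sub hF.aestronglyMeasurable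
    have hGy := (hG.memLp_line hy).1.sub hG.aestronglyMeasurable
    have hsplit : (fun x : ℝ => F (x + y * I) * G (x + y * I) - f x * g x) =
        (fun x : ℝ => (F (x + y * I) - f x) * G (x + y * I)) +
          fun x : ℝ => f x * (G (x + y * I) - g x) :=
      funext fun x => by simp only [Pi.add_apply]; ring
    rw [hsplit]
    refine (eLpNorm_add_le (hFy.mul (hG.memLp_line hy).1)
      (hF.aestronglyMeasurable.mul hGy) hr).trans (add_le_add ?_ ?_)
    · exact (holder hFy (hG.memLp_line hy).1).trans (mul_le_mul' le_rfl (hD y hy))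
    · exact holder hF.aestronglyMeasurable hGy

theorem reflect (h : IsHardyFun p f F) :
    IsHardyFun p (fun x => conj (f (-x))) (fun z => conj (F (-conj z))) := by
  have hneg : MeasurePreserving (fun x : ℝ => -x) volume volume := Measure.measurePreserving_neg _
  refine ⟨Complex.continuous_conj.comp_aestronglyMeasurable
    (h.aestronglyMeasurable.comp_measurePreserving hneg), fun z hz => ?_, ?_, ?_⟩
  · have hF : DifferentiableAt ℂ F (-conj z) :=
      h.analytic.differentiableAt (UpperHalfPlane.isOpen_upperHalfPlaneSet.mem_nhds (by simpa))
    have hFneg : DifferentiableAt ℂ (fun u => F (-u)) (conj z) :=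
      hF.comp (conj z) differentiableAt_id.neg
    simpa only [Function.comp_def, Complex.conj_conj] using
      hFneg.conj_conj.differentiableWithinAt
  · obtain ⟨C, hC⟩ := h.bounded
    refine ⟨C, fun y hy => le_of_eq_of_le ?_ (hC y hy)⟩
    rw [← eLpNorm_comp_measurePreserving (h.memLp_line hy).1 hneg]
    refine eLpNorm_congr_norm_ae (.of_forall fun x => ?_)
    simp only [neg_conj_add_mul_I, RCLike.norm_conj, Function.comp_apply]
  · refine h.boundary.congr' ?_
    filter_upwards [self_mem_nhdsWithin] with y hy
    refine (eLpNorm_comp_measurePreserving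
      ((h.memLp_line hy).1.sub h.aestronglyMeasurable) hneg).symm.trans ?_
    refine eLpNorm_congr_norm_ae (.of_forall fun x => ?_)
    simp only [neg_conj_add_mul_I, Function.comp_apply, ← map_sub, RCLike.norm_conj, Pi.sub_apply]

end IsHardyFun

theorem norm_mul_sub_mul_le {R : Type*} [SeminormedRing R] (a b c d : R) :
    ‖a * b - c * d‖ ≤ ‖a‖ * ‖b - d‖ + ‖a - c‖ * ‖d‖ := by
  rw [show a * b - c * d = a * (b - d) + (a - c) * d by noncomm_ring]
  exact norm_add_le_of_le (norm_mul_le _ _) (norm_mul_le _ _)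

/-- A bounded analytic function in the upper half-plane which extends to the closed half-plane and
is Lipschitz in the vertical direction; such functions multiply Hardy classes into themselves. -/
structure IsMultiplier (m : ℂ → ℂ) : Prop where
  analytic : DifferentiableOn ℂ m {z : ℂ | 0 < z.im}
  continuous : Continuous fun x : ℝ => m x
  bounded : ∃ C : ℝ≥0, ∀ z : ℂ, 0 ≤ z.im → ‖m z‖ ≤ C
  lipschitz : ∃ L : ℝ≥0, ∀ x y : ℝ, 0 < y → ‖m (x + y * I) - m x‖ ≤ L * y

theorem IsMultiplier.const (c : ℂ) : IsMultiplier fun _ => c :=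
  ⟨differentiableOn_const c, continuous_const, ⟨‖c‖₊, fun _ _ => by simp⟩,
    ⟨0, fun _ _ _ => by simp⟩⟩

theorem IsMultiplier.add {m n : ℂ → ℂ} (hm : IsMultiplier m) (hn : IsMultiplier n) :
    IsMultiplier (m + n) := by
  obtain ⟨C, hC⟩ := hm.bounded
  obtain ⟨D, hD⟩ := hn.bounded
  obtain ⟨L, hL⟩ := hm.lipschitz
  obtain ⟨N, hN⟩ := hn.lipschitz
  refine ⟨hm.analytic.add hn.analytic, hm.continuous.add hn.continuous,
    ⟨C + D, fun z hz => ?_⟩, ⟨L + N, fun x y hy => ?_⟩⟩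
  · exact (norm_add_le _ _).trans (add_le_add (hC z hz) (hD z hz))
  · rw [Pi.add_apply, Pi.add_apply, add_sub_add_comm, NNReal.coe_add, add_mul]
    exact (norm_add_le _ _).trans (add_le_add (hL x y hy) (hN x y hy))

theorem IsMultiplier.mul {m n : ℂ → ℂ} (hm : IsMultiplier m) (hn : IsMultiplier n) :
    IsMultiplier (m * n) := by
  obtain ⟨C, hC⟩ := hm.bounded
  obtain ⟨D, hD⟩ := hn.bounded
  obtain ⟨L, hL⟩ := hm.lipschitz
  obtain ⟨N, hN⟩ := hn.lipschitz
  refine ⟨hm.analytic.mul hn.analytic, hm.continuous.mul hn.continuous,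
    ⟨C * D, fun z hz => ?_⟩, ⟨C * N + L * D, fun x y hy => ?_⟩⟩
  · rw [Pi.mul_apply, norm_mul, NNReal.coe_mul]
    gcongr
    exacts [hC z hz, hD z hz]
  · have hmz := hC (x + y * I) (by simpa using hy.le)
    have hnx := hD x (by simp)
    calc ‖m (x + y * I) * n (x + y * I) - m x * n x‖
      _ ≤ ‖m (x + y * I)‖ * ‖n (x + y * I) - n x‖ + ‖m (x + y * I) - m x‖ * ‖n x‖ :=
          norm_mul_sub_mul_le ..
      _ ≤ C * (N * y) + L * y * D := by
          gcongr
          exacts [hN x y hy, hL x y hy]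
      _ = (C * N + L * D : ℝ≥0) * y := by push_cast; ring

/-- The algebra of multipliers of the Hardy classes. Its elements are functions on all of `ℂ`, of
which only the values on the closed upper half-plane matter. -/
def multiplierAlgebra : Subalgebra ℂ (ℂ → ℂ) where
  carrier := {m | IsMultiplier m}
  mul_mem' := .mul
  add_mem' := .add
  algebraMap_mem' := .const

instance : CoeFun multiplierAlgebra fun _ => ℂ → ℂ := ⟨Subtype.val⟩

theorem norm_inv_sub_le {z a : ℂ} {δ : ℝ} (hδ : 0 < δ) (h : δ ≤ |z.im - a.im|) :
    ‖(z - a)⁻¹‖ ≤ δ⁻¹ := by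
  rw [norm_inv]
  exact inv_anti₀ hδ (h.trans (by simpa using Complex.abs_im_le_norm (z - a)))

theorem norm_inv_sub_inv_sub_le {a : ℂ} {x y δ : ℝ} (hδ : 0 < δ) (ha : a.im ≠ 0)
    (h : δ ≤ |y - a.im|) :
    ‖((x : ℂ) + y * I - a)⁻¹ - ((x : ℂ) - a)⁻¹‖ ≤ δ⁻¹ * |y| * ‖((x : ℂ) - a)⁻¹‖ := by
  have hx : (x : ℂ) - a ≠ 0 := fun h0 => ha (by simp [← sub_eq_zero.1 h0])
  have hz : (x : ℂ) + y * I - a ≠ 0 := fun h0 => by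
    simp [← sub_eq_zero.1 h0] at h
    linarith
  calc ‖((x : ℂ) + y * I - a)⁻¹ - ((x : ℂ) - a)⁻¹‖
    _ = ‖-(((x : ℂ) + y * I - a)⁻¹ * (y * I) * ((x : ℂ) - a)⁻¹)‖ := by
        congr 1
        field_simp
        ring
    _ = ‖((x : ℂ) + y * I - a)⁻¹‖ * |y| * ‖((x : ℂ) - a)⁻¹‖ := by simp
    _ ≤ δ⁻¹ * |y| * ‖((x : ℂ) - a)⁻¹‖ := by
        gcongr
        exact norm_inv_sub_le hδ (by rwa [add_mul_I_im])

theorem sub_ne_zero_of_im_neg {β z : ℂ} (hβ : β.im < 0) (hz : 0 ≤ z.im) : z - β ≠ 0 :=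
  fun h => by
    rw [sub_eq_zero.1 h] at hz
    exact hβ.not_ge hz

theorem isMultiplier_inv_sub {β : ℂ} (hβ : β.im < 0) : IsMultiplier fun z => (z - β)⁻¹ := by
  have hδ : 0 < -β.im := neg_pos.2 hβ
  have hle {y : ℝ} (hy : 0 ≤ y) : -β.im ≤ |y - β.im| :=
    (by linarith : -β.im ≤ y - β.im).trans (le_abs_self _)
  have hne {z : ℂ} (hz : 0 ≤ z.im) : z - β ≠ 0 := sub_ne_zero_of_im_neg hβ hz
  refine ⟨fun z hz => ?_, Continuous.inv₀ (by fun_prop) fun x => hne (by simp),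
    ⟨⟨(-β.im)⁻¹, by positivity⟩, fun z hz => norm_inv_sub_le hδ (hle hz)⟩,
    ⟨⟨(-β.im)⁻¹ * (-β.im)⁻¹, by positivity⟩, fun x y hy => ?_⟩⟩
  · have hz0 := hne (le_of_lt hz)
    fun_prop (disch := assumption)
  · calc ‖((x : ℂ) + y * I - β)⁻¹ - ((x : ℂ) - β)⁻¹‖
      _ ≤ (-β.im)⁻¹ * |y| * ‖((x : ℂ) - β)⁻¹‖ := norm_inv_sub_inv_sub_le hδ hβ.ne (hle hy.le)
      _ ≤ (-β.im)⁻¹ * |y| * (-β.im)⁻¹ := by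
          gcongr
          exact norm_inv_sub_le hδ (hle (by simp))
      _ = (-β.im)⁻¹ * (-β.im)⁻¹ * y := by rw [abs_of_pos hy]; ring

namespace IsHardyFun

variable {p : ℝ≥0∞} {f : ℝ → ℂ} {F : ℂ → ℂ}

theorem multiplier_mul (h : IsHardyFun p f F) (hp : 1 ≤ p) {m : ℂ → ℂ} (hm : IsMultiplier m) :
    IsHardyFun p (fun x => m x * f x) (fun z => m z * F z) := by
  obtain ⟨C, hC⟩ := h.bounded
  obtain ⟨D, hD⟩ := hm.bounded
  obtain ⟨L, hL⟩ := hm.lipschitz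
  refine ⟨hm.continuous.aestronglyMeasurable.mul h.aestronglyMeasurable,
    hm.analytic.mul h.analytic, ⟨D * C, fun y hy => ?_⟩,
    h.tendsto_boundary_of_le hp (c := D) (L := L) ?_⟩
  · refine (eLpNorm_le_nnreal_smul_eLpNorm_of_ae_le_mul (c := D)
      (g := fun x : ℝ => F (x + y * I)) (.of_forall fun x => ?_) p).trans ?_
    · rw [← NNReal.coe_le_coe, NNReal.coe_mul, coe_nnnorm, coe_nnnorm, norm_mul]
      gcongr
      exact hD _ (by simpa using hy.le)
    · rw [ENNReal.smul_def, smul_eq_mul, ENNReal.coe_mul]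
      exact mul_le_mul_right (hC y hy) _
  · filter_upwards [self_mem_nhdsWithin] with y hy x
    have hy : 0 < y := hy
    calc ‖m (x + y * I) * F (x + y * I) - m x * f x‖
      _ ≤ ‖m (x + y * I)‖ * ‖F (x + y * I) - f x‖ + ‖m (x + y * I) - m x‖ * ‖f x‖ :=
          norm_mul_sub_mul_le ..
      _ ≤ D * ‖F (x + y * I) - f x‖ + L * y * ‖f x‖ := by
          gcongr
          exacts [hD _ (by simpa using hy.le), hL x y hy]

theorem exists_norm_dslope_le {a : ℂ} (ha : 0 < a.im)
    (hF : DifferentiableOn ℂ F {z : ℂ | 0 < z.im}) (hFa : F a = 0) :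
    ∃ c B : ℝ≥0, ∀ x y : ℝ, ‖dslope F a (x + y * I)‖ ≤
      c * ‖F (x + y * I)‖ + (Metric.closedBall a.re (a.im / 2)).indicator (fun _ => (B : ℝ)) x := by
  have hd := (Complex.differentiableOn_dslope
    (UpperHalfPlane.isOpen_upperHalfPlaneSet.mem_nhds ha)).2 hF
  have hball : Metric.closedBall a (a.im / 2) ⊆ {z : ℂ | 0 < z.im} := fun z hz => by
    have him := (Complex.abs_im_le_norm (z - a)).trans (mem_closedBall_iff_norm.1 hz)
    rw [Complex.sub_im, abs_le] at him
    exact (by linarith : 0 < z.im)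
  obtain ⟨B, hB⟩ := (isCompact_closedBall a (a.im / 2)).exists_bound_of_continuousOn
    (hd.continuousOn.mono hball)
  refine ⟨⟨(a.im / 2)⁻¹, by positivity⟩, B.toNNReal, fun x y => ?_⟩
  set z : ℂ := x + y * I with hz
  have hzre : z.re = x := by simp [hz]
  by_cases hza : z ∈ Metric.closedBall a (a.im / 2)
  · have hx : x ∈ Metric.closedBall a.re (a.im / 2) := by
      rw [mem_closedBall_iff_norm] at hza ⊢
      simpa [hzre] using (Complex.abs_re_le_norm (z - a)).trans hza
    rw [Set.indicator_of_mem hx]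
    exact ((hB z hza).trans (Real.le_coe_toNNReal B)).trans (le_add_of_nonneg_left
      (mul_nonneg (NNReal.coe_nonneg _) (norm_nonneg _)))
  · rw [mem_closedBall_iff_norm, not_le] at hza
    have hne : z ≠ a := fun h0 => by
      rw [h0, sub_self, norm_zero] at hza
      linarith
    rw [dslope_of_ne _ hne, slope_def_field, hFa, sub_zero, norm_div, div_eq_inv_mul]
    refine le_add_of_le_of_nonneg ?_ (Set.indicator_nonneg (fun _ _ => B.toNNReal.2) _)
    exact mul_le_mul_of_nonneg_right (inv_anti₀ (half_pos ha) hza.le) (norm_nonneg _)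

theorem norm_dslope_sub_div_sub_le {a : ℂ} (hFa : F a = 0) {y : ℝ}
    (hy : y ∈ Set.Ioo 0 (a.im / 2)) (x : ℝ) : ‖dslope F a (x + y * I) - f x / (x - a)‖ ≤
      (a.im / 2)⁻¹ * ‖F (x + y * I) - f x‖ + (a.im / 2)⁻¹ * a.im⁻¹ * y * ‖f x‖ := by
  have hδ : 0 < a.im / 2 := hy.1.trans hy.2
  have ha : 0 < a.im := by linarith
  have him : a.im / 2 ≤ |y - a.im| := by
    rw [abs_sub_comm]
    exact (by linarith [hy.2] : a.im / 2 ≤ a.im - y).trans (le_abs_self _)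
  have hne : (x : ℂ) + y * I ≠ a := fun h0 => by
    rw [← h0, add_mul_I_im] at hy
    linarith [hy.1, hy.2]
  rw [dslope_of_ne _ hne, slope_def_field, hFa, sub_zero]
  calc ‖F (x + y * I) / (x + y * I - a) - f x / (x - a)‖
    _ ≤ ‖((x : ℂ) + y * I - a)⁻¹‖ * ‖F (x + y * I) - f x‖ +
          ‖((x : ℂ) + y * I - a)⁻¹ - (x - a : ℂ)⁻¹‖ * ‖f x‖ := by
        rw [div_eq_inv_mul, div_eq_inv_mul]
        exact norm_mul_sub_mul_le ..
    _ ≤ (a.im / 2)⁻¹ * ‖F (x + y * I) - f x‖ + (a.im / 2)⁻¹ * y * a.im⁻¹ * ‖f x‖ := by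
        gcongr
        · exact norm_inv_sub_le hδ (by rwa [add_mul_I_im])
        · refine (norm_inv_sub_inv_sub_le hδ ha.ne' him).trans ?_
          rw [abs_of_pos hy.1]
          gcongr
          · exact mul_nonneg (by positivity) hy.1.le
          · exact norm_inv_sub_le ha (by simp [abs_of_pos ha])
    _ = (a.im / 2)⁻¹ * ‖F (x + y * I) - f x‖ + (a.im / 2)⁻¹ * a.im⁻¹ * y * ‖f x‖ := by ring

theorem div_sub (h : IsHardyFun p f F) (hp : 1 ≤ p) {a : ℂ} (ha : 0 < a.im) (hFa : F a = 0) :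
    IsHardyFun p (fun x => f x / (x - a)) (dslope F a) where
  aestronglyMeasurable := h.aestronglyMeasurable.div₀ (by fun_prop)
  analytic := (Complex.differentiableOn_dslope
    (UpperHalfPlane.isOpen_upperHalfPlaneSet.mem_nhds ha)).2 h.analytic
  bounded := by
    obtain ⟨C, hC⟩ := h.bounded
    obtain ⟨c, B, hcB⟩ := exists_norm_dslope_le ha h.analytic hFa
    have hind : MemLp ((Metric.closedBall a.re (a.im / 2)).indicator fun _ : ℝ => (B : ℝ)) p :=
      memLp_indicator_const p Metric.isClosed_closedBall.measurableSet _
        (.inr measure_closedBall_lt_top.ne)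
    refine ⟨c * C + (eLpNorm ((Metric.closedBall a.re (a.im / 2)).indicator
      fun _ => (B : ℝ)) p).toNNReal, fun y hy => (eLpNorm_mono_real (hcB · y)).trans
      ((eLpNorm_add_le ((h.memLp_line hy).1.norm.const_mul _) hind.1 hp).trans ?_)⟩
    rw [ENNReal.coe_add, ENNReal.coe_toNNReal hind.2.ne, ENNReal.coe_mul]
    refine add_le_add_left ((eLpNorm_const_smul_le (c := (c : ℝ))).trans ?_) _
    rw [eLpNorm_norm]
    simpa using mul_le_mul_right (hC y hy) _
  boundary := by
    refine h.tendsto_boundary_of_le hp (c := ⟨(a.im / 2)⁻¹, by positivity⟩)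
      (L := ⟨(a.im / 2)⁻¹ * a.im⁻¹, by positivity⟩) ?_
    filter_upwards [Ioo_mem_nhdsGT (half_pos ha)] with y hy
    exact norm_dslope_sub_div_sub_le hFa hy

theorem exists_integral_norm_le (h : IsHardyFun 1 f F) :
    ∃ C : ℝ, ∀ y : ℝ, 0 < y → ∫ x : ℝ, ‖F (x + y * I)‖ ≤ C := by
  obtain ⟨C, hC⟩ := h.bounded
  refine ⟨C, fun y hy => ?_⟩
  rw [integral_norm_eq_lintegral_enorm (h.memLp_line hy).1, ← eLpNorm_one_eq_lintegral_enorm]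
  exact ENNReal.toReal_mono ENNReal.coe_ne_top (hC y hy)

theorem integrable_strip (h : IsHardyFun 1 f F) {y₁ : ℝ} (hy₁ : 0 < y₁) (y₂ : ℝ) :
    Integrable (fun q : ℝ × ℝ => F (q.1 + q.2 * I))
      (volume.prod (volume.restrict (Set.Ioc y₁ y₂))) := by
  have hmeas : AEStronglyMeasurable (fun q : ℝ × ℝ => F (q.1 + q.2 * I))
      (volume.prod (volume.restrict (Set.Ioc y₁ y₂))) := by
    rw [← Measure.restrict_univ (μ := volume), Measure.prod_restrict]
    refine ContinuousOn.aestronglyMeasurable (h.analytic.continuousOn.comp (by fun_prop) ?_)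
      (MeasurableSet.univ.prod measurableSet_Ioc)
    exact fun q hq => by simpa using hy₁.trans hq.2.1
  obtain ⟨C, hC⟩ := h.exists_integral_norm_le
  rw [integrable_prod_iff' hmeas]
  constructor
  · filter_upwards [ae_restrict_mem measurableSet_Ioc] with y hy
    exact memLp_one_iff_integrable.1 (h.memLp_line (hy₁.trans hy.1))
  · refine (integrable_const C).mono' hmeas.norm.prod_swap.integral_prod_right' ?_
    filter_upwards [ae_restrict_mem measurableSet_Ioc] with y hy
    rw [Real.norm_of_nonneg (integral_nonneg fun _ => norm_nonneg _)]
    exact hC y (hy₁.trans hy.1)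

theorem intervalIntegral_sub_eq (hF : DifferentiableOn ℂ F {z : ℂ | 0 < z.im}) {y₁ y₂ : ℝ}
    (hy₁ : 0 < y₁) (hy : y₁ ≤ y₂) (R : ℝ) :
    (∫ x in -R..R, F (x + y₁ * I)) - ∫ x in -R..R, F (x + y₂ * I) =
      I * (∫ y in y₁..y₂, F ((-R : ℝ) + y * I)) - I * ∫ y in y₁..y₂, F (R + y * I) := by
  have hrect := Complex.integral_boundary_rect_eq_zero_of_differentiableOn F
    ((-R : ℝ) + y₁ * I) (R + y₂ * I) (hF.mono fun z hz => ?_)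
  · simp only [Complex.add_re, Complex.ofReal_re, Complex.mul_re, Complex.I_re, mul_zero,
      Complex.ofReal_im, Complex.I_im, mul_one, sub_self, add_zero, Complex.add_im,
      Complex.mul_im, zero_add, smul_eq_mul] at hrect
    linear_combination hrect
  · have him := hz.2
    rw [add_mul_I_im, add_mul_I_im, Set.uIcc_of_le hy] at him
    exact hy₁.trans_le him.1

theorem integral_line_eq_integral_line (h : IsHardyFun 1 f F) {y₁ y₂ : ℝ} (hy₁ : 0 < y₁)
    (hy : y₁ ≤ y₂) : ∫ x : ℝ, F (x + y₁ * I) = ∫ x : ℝ, F (x + y₂ * I) := by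
  have hlim {y : ℝ} (hy : 0 < y) : Tendsto (fun R : ℝ => ∫ x in -R..R, F (x + y * I)) atTop
      (𝓝 (∫ x : ℝ, F (x + y * I))) :=
    intervalIntegral_tendsto_integral (memLp_one_iff_integrable.1 (h.memLp_line hy))
      tendsto_neg_atTop_atBot tendsto_id
  have hside : Integrable fun R : ℝ => ∫ y in y₁..y₂, F (R + y * I) := by
    simpa only [intervalIntegral.integral_of_le hy] using
      (h.integrable_strip hy₁ y₂).integral_prod_left
  have hdiff : Integrable fun R : ℝ =>
      (∫ x in -R..R, F (x + y₁ * I)) - ∫ x in -R..R, F (x + y₂ * I) := by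
    simp only [intervalIntegral_sub_eq h.analytic hy₁ hy]
    exact (hside.comp_neg.const_mul I).sub (hside.const_mul I)
  -- An integrable function of `R` can only converge to `0` as `R → ∞`.
  exact sub_eq_zero.1 <| (hdiff.integrableAtFilter atTop).eq_zero_of_tendsto
    (fun s hs => by
      obtain ⟨R, hR⟩ := mem_atTop_sets.1 hs
      exact top_unique (Real.volume_Ici.ge.trans (measure_mono hR)))
    ((hlim hy₁).sub (hlim (hy₁.trans_le hy)))

theorem integral_line_eq_integral (h : IsHardyFun 1 f F) {y : ℝ} (hy : 0 < y) :
    ∫ x : ℝ, F (x + y * I) = ∫ x, f x := by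
  have hlim : Tendsto (fun y : ℝ => ∫ x : ℝ, F (x + y * I)) (𝓝[>] 0) (𝓝 (∫ x, f x)) := by
    refine tendsto_integral_of_L1' f h.aestronglyMeasurable ?_ h.boundary
    filter_upwards [self_mem_nhdsWithin] with y hy
    exact memLp_one_iff_integrable.1 (h.memLp_line hy)
  refine tendsto_nhds_unique (tendsto_const_nhds.congr' ?_) hlim
  filter_upwards [Ioo_mem_nhdsGT hy] with t ht
  exact (h.integral_line_eq_integral_line ht.1 ht.2.le).symm

theorem integral_div_sub_eq_zero (h : IsHardyFun 1 f F) {a : ℂ} (ha : 0 < a.im) (hFa : F a = 0) :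
    ∫ x, f x / (x - a) = 0 := by
  obtain ⟨C, hC⟩ := h.exists_integral_norm_le
  have hbound : ∀ y : ℝ, a.im < y → ‖∫ x, f x / (x - a)‖ ≤ (y - a.im)⁻¹ * C := by
    intro y hy
    have hδ : 0 < y - a.im := sub_pos.2 hy
    have hy0 : 0 < y := ha.trans hy
    rw [← (h.div_sub le_rfl ha hFa).integral_line_eq_integral hy0]
    have hpoint (x : ℝ) : ‖dslope F a (x + y * I)‖ ≤ (y - a.im)⁻¹ * ‖F (x + y * I)‖ := by
      have hne : (x : ℂ) + y * I ≠ a := fun h0 => by simp [← h0] at hy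
      rw [dslope_of_ne _ hne, slope_def_field, hFa, sub_zero, div_eq_inv_mul, norm_mul]
      gcongr
      exact norm_inv_sub_le hδ (by simp [le_abs_self])
    have hint := (memLp_one_iff_integrable.1 (h.memLp_line hy0)).norm
    refine (norm_integral_le_of_norm_le (hint.const_mul _) (.of_forall hpoint)).trans ?_
    rw [integral_const_mul]
    gcongr
    exact hC y hy0
  have hdecay : Tendsto (fun y : ℝ => (y - a.im)⁻¹ * C) atTop (𝓝 0) := by
    simpa [Function.comp_def, sub_eq_add_neg] using (tendsto_inv_atTop_zero.comp
      (tendsto_atTop_add_const_right atTop (-a.im) tendsto_id)).mul_const C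
  exact norm_le_zero_iff.1 <| ge_of_tendsto hdecay <|
    (eventually_gt_atTop a.im).mono hbound

end IsHardyFun

theorem ofReal_sub_ne_zero {a : ℂ} (ha : a.im ≠ 0) (x : ℝ) : (x : ℂ) - a ≠ 0 :=
  fun h => ha (by simp [← sub_eq_zero.1 h])

theorem sq_norm_inv_sub (a : ℂ) (x : ℝ) :
    ‖((x : ℂ) - a)⁻¹‖ ^ 2 = ((x - a.re) ^ 2 + a.im ^ 2)⁻¹ := by
  rw [norm_inv, inv_pow, Complex.sq_norm, Complex.normSq_apply]
  simp [sq]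

theorem memLp_inv_sub {a : ℂ} (ha : a.im ≠ 0) : MemLp (fun x : ℝ => ((x : ℂ) - a)⁻¹) 2 := by
  have hcont : Continuous fun x : ℝ => ((x : ℂ) - a)⁻¹ :=
    Continuous.inv₀ (by fun_prop) (ofReal_sub_ne_zero ha)
  rw [memLp_two_iff_integrable_sq_norm hcont.aestronglyMeasurable]
  have hcauchy := (ProbabilityTheory.integrable_cauchyPDFReal a.re
    (γ := ‖a.im‖₊)).const_mul (Real.pi * |a.im|⁻¹)
  refine hcauchy.congr (.of_forall fun x => ?_)
  have habs : |a.im| ≠ 0 := abs_ne_zero.2 ha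
  simp only [sq_norm_inv_sub, ProbabilityTheory.cauchyPDFReal_def, coe_nnnorm, Real.norm_eq_abs,
    sq_abs]
  field_simp

theorem integral_sq_norm_inv_sub {a : ℂ} (ha : 0 < a.im) :
    ∫ x : ℝ, ‖((x : ℂ) - a)⁻¹‖ ^ 2 = Real.pi / a.im := by
  have hcauchy := ProbabilityTheory.integral_cauchyPDFReal_eq_one a.re
    (Real.toNNReal_pos.2 ha).ne'
  simp only [ProbabilityTheory.cauchyPDFReal_def, Real.coe_toNNReal _ ha.le,
    integral_const_mul] at hcauchy
  simp only [sq_norm_inv_sub]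
  field_simp at hcauchy ⊢
  exact hcauchy

theorem isHardyFun_inv_sub {β : ℂ} (hβ : β.im < 0) :
    IsHardyFun 2 (fun x => ((x : ℂ) - β)⁻¹) fun z => (z - β)⁻¹ := by
  have hmem := memLp_inv_sub hβ.ne
  have hδ : 0 < -β.im := neg_pos.2 hβ
  refine ⟨hmem.1, (isMultiplier_inv_sub hβ).analytic,
    ⟨(eLpNorm (fun x : ℝ => ((x : ℂ) - β)⁻¹) 2).toNNReal, fun y hy => ?_⟩, ?_⟩
  · rw [ENNReal.coe_toNNReal hmem.2.ne]
    refine eLpNorm_mono fun x => ?_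
    rw [norm_inv, norm_inv]
    refine inv_anti₀ (norm_pos_iff.2 (ofReal_sub_ne_zero hβ.ne x)) ?_
    rw [← sq_le_sq₀ (norm_nonneg _) (norm_nonneg _), Complex.sq_norm, Complex.sq_norm,
      Complex.normSq_apply, Complex.normSq_apply]
    simp only [Complex.sub_re, Complex.sub_im, Complex.add_re, Complex.add_im, Complex.ofReal_re,
      Complex.ofReal_im, Complex.re_ofReal_mul, Complex.im_ofReal_mul, Complex.I_re, Complex.I_im]
    nlinarith
  · have hlim : Tendsto (fun y : ℝ => ‖(-β.im)⁻¹ * |y|‖ₑ *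
        eLpNorm (fun x : ℝ => ((x : ℂ) - β)⁻¹) 2) (𝓝[>] 0) (𝓝 0) := by
      have hcont : Continuous fun y : ℝ => ‖(-β.im)⁻¹ * |y|‖ₑ := by fun_prop
      simpa using ENNReal.Tendsto.mul_const ((hcont.tendsto 0).mono_left nhdsWithin_le_nhds)
        (.inr hmem.2.ne)
    refine tendsto_of_tendsto_of_tendsto_of_le_of_le' tendsto_const_nhds hlim
      (.of_forall fun _ => zero_le) ?_
    filter_upwards [self_mem_nhdsWithin] with y hy
    rw [← eLpNorm_norm fun x : ℝ => ((x : ℂ) - β)⁻¹, ← eLpNorm_const_smul]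
    refine eLpNorm_mono_real fun x => norm_inv_sub_inv_sub_le hδ hβ.ne ?_
    exact (by linarith [Set.mem_Ioi.1 hy] : -β.im ≤ y - β.im).trans (le_abs_self _)

theorem integral_inv_sub_sq {β : ℂ} (hβ : β.im ≠ 0) : ∫ x : ℝ, ((x : ℂ) - β)⁻¹ ^ 2 = 0 := by
  have hlim {l : Filter ℝ} (hl : Tendsto (fun x : ℝ => (x : ℂ)) l (Bornology.cobounded ℂ)) :
      Tendsto (fun x : ℝ => -((x : ℂ) - β)⁻¹) l (𝓝 0) := by
    simpa using (tendsto_inv₀_cobounded.comp ((tendsto_sub_const_cobounded β).comp hl)).neg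
  have hderiv (x : ℝ) : HasDerivAt (fun x : ℝ => -((x : ℂ) - β)⁻¹) (((x : ℂ) - β)⁻¹ ^ 2) x := by
    have hsub : HasDerivAt (fun x : ℝ => (x : ℂ) - β) 1 x := by
      simpa using (hasDerivAt_id x).ofReal_comp.sub_const β
    simpa [neg_div] using (hsub.fun_inv (ofReal_sub_ne_zero hβ x)).fun_neg
  have hint : Integrable fun x : ℝ => ((x : ℂ) - β)⁻¹ ^ 2 := by
    simpa only [pow_two] using! (memLp_inv_sub hβ).integrable_mul (memLp_inv_sub hβ)
  simpa using integral_of_hasDerivAt_of_tendsto hderiv hint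
    (hlim (RCLike.tendsto_ofReal_atBot_cobounded ℂ))
    (hlim (RCLike.tendsto_ofReal_atTop_cobounded ℂ))

theorem integral_inv_sub_sub_inv_sub_conj {a : ℂ} (ha : 0 < a.im) :
    ∫ x : ℝ, (((x : ℂ) - a)⁻¹ - ((x : ℂ) - conj a)⁻¹) = 2 * Real.pi * I := by
  have hpoint (x : ℝ) : ((x : ℂ) - a)⁻¹ - ((x : ℂ) - conj a)⁻¹ =
      2 * a.im * I * (‖((x : ℂ) - a)⁻¹‖ ^ 2 : ℝ) := by
    have hx := ofReal_sub_ne_zero ha.ne' x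
    have hx' : (x : ℂ) - conj a ≠ 0 := ofReal_sub_ne_zero (by simpa using ha.ne') x
    rw [Complex.ofReal_pow, ← Complex.mul_conj', map_inv₀, map_sub, Complex.conj_ofReal]
    field_simp
    rw [sub_sub_sub_cancel_left, Complex.sub_conj]
    push_cast
    ring
  simp only [hpoint]
  rw [integral_const_mul, integral_complex_ofReal, integral_sq_norm_inv_sub ha]
  have ha' : (a.im : ℂ) ≠ 0 := Complex.ofReal_ne_zero.2 ha.ne'
  push_cast
  field_simp

theorem integrable_div_sub {f : ℝ → ℂ} (hf : Integrable f) {a : ℂ} (ha : a.im ≠ 0) :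
    Integrable fun x => f x / (x - a) := by
  simp only [div_eq_mul_inv]
  refine hf.mul_bdd (c := |a.im|⁻¹) (memLp_inv_sub ha).1 (.of_forall fun x => ?_)
  exact norm_inv_sub_le (abs_pos.2 ha) (by simp)

theorem integral_sq_sub_conj_inv_div_sub {a : ℂ} (ha : 0 < a.im) :
    ∫ x : ℝ, ((a - conj a) ^ 2 * (((x : ℂ) - conj a)⁻¹ * ((x : ℂ) - conj a)⁻¹)) / (x - a) =
      2 * Real.pi * I := by
  have ha' : (conj a).im ≠ 0 := by simpa using ha.ne'
  have hfactor (x : ℝ) : ((x : ℂ) - a)⁻¹ - ((x : ℂ) - conj a)⁻¹ =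
      (a - conj a) * (((x : ℂ) - a)⁻¹ * ((x : ℂ) - conj a)⁻¹) := by
    have hx := ofReal_sub_ne_zero ha.ne' x
    have hx' := ofReal_sub_ne_zero ha' x
    field_simp
    ring
  have hfraction (x : ℝ) :
      ((a - conj a) ^ 2 * (((x : ℂ) - conj a)⁻¹ * ((x : ℂ) - conj a)⁻¹)) / (x - a) =
        (((x : ℂ) - a)⁻¹ - ((x : ℂ) - conj a)⁻¹) - (a - conj a) * ((x : ℂ) - conj a)⁻¹ ^ 2 := by
    have hx := ofReal_sub_ne_zero ha.ne' x
    have hx' := ofReal_sub_ne_zero ha' x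
    field_simp
    ring
  have hint : Integrable fun x : ℝ => ((x : ℂ) - a)⁻¹ - ((x : ℂ) - conj a)⁻¹ := by
    simp only [hfactor]
    exact ((memLp_inv_sub ha.ne').integrable_mul (memLp_inv_sub ha')).const_mul _
  have hintSq : Integrable fun x : ℝ => ((x : ℂ) - conj a)⁻¹ ^ 2 := by
    simpa only [pow_two] using! (memLp_inv_sub ha').integrable_mul (memLp_inv_sub ha')
  simp only [hfraction]
  rw [integral_sub hint (hintSq.const_mul _), integral_inv_sub_sub_inv_sub_conj ha,
    integral_const_mul, integral_inv_sub_sq ha', mul_zero, sub_zero]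

theorem IsHardyFun.integral_div_sub {f : ℝ → ℂ} {F : ℂ → ℂ} (h : IsHardyFun 1 f F) {a : ℂ}
    (ha : 0 < a.im) : ∫ x, f x / (x - a) = 2 * Real.pi * I * F a := by
  have hβ : (conj a).im < 0 := by simpa using ha
  -- The reference function `((a - ā) / (z - ā))²` takes the value `1` at `a`.
  have href := (((isHardyFun_inv_sub hβ).mul (q := 2) (r := 1) le_rfl
    (isHardyFun_inv_sub hβ)).multiplier_mul le_rfl (.const ((a - conj a) ^ 2)))
  have hvanish := (h.add (href.multiplier_mul le_rfl (.const (-F a))) le_rfl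
    ).integral_div_sub_eq_zero ha (by
      have hne : a - conj a ≠ 0 := sub_ne_zero_of_im_neg hβ ha.le
      field_simp
      ring)
  have hf := integrable_div_sub (memLp_one_iff_integrable.1 h.memLp) ha.ne'
  have hg := integrable_div_sub (memLp_one_iff_integrable.1 href.memLp) ha.ne'
  simp only [add_div, mul_div_assoc (-F a)] at hvanish
  rw [integral_add hf (hg.const_mul _), integral_const_mul,
    integral_sq_sub_conj_inv_div_sub ha] at hvanish
  linear_combination hvanish

theorem IsHardyFun.extension_eq {f : ℝ → ℂ} {F G : ℂ → ℂ} (hF : IsHardyFun 2 f F)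
    (hG : IsHardyFun 2 f G) {a : ℂ} (ha : 0 < a.im) : F a = G a := by
  have hI : (-I).im < 0 := by simp
  have hcauchy {F : ℂ → ℂ} (hF : IsHardyFun 2 f F) :=
    (hF.mul (r := 1) le_rfl (isHardyFun_inv_sub hI)).integral_div_sub ha
  have heq := (hcauchy hF).symm.trans (hcauchy hG)
  exact mul_right_cancel₀ (inv_ne_zero (sub_ne_zero_of_im_neg hI ha.le))
    (mul_left_cancel₀ Complex.two_pi_I_ne_zero heq)

/-- The element of `H²₊` with given boundary values. -/
noncomputable def IsHardyFun.toHardy {f : ℝ → ℂ} {F : ℂ → ℂ} (h : IsHardyFun 2 f F) : hardyPlus :=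
  have hae := h.congr_ae h.memLp.coeFn_toLp.symm
  ⟨h.memLp.toLp f, F, hae.analytic, hae.bounded, hae.boundary⟩

noncomputable instance : CoeFun hardyPlus fun _ => ℝ → ℂ :=
  ⟨fun w => (w : Lp ℂ 2 (volume : Measure ℝ))⟩

theorem IsHardyFun.coeFn_toHardy {f : ℝ → ℂ} {F : ℂ → ℂ} (h : IsHardyFun 2 f F) :
    h.toHardy =ᵐ[volume] f :=
  h.memLp.coeFn_toLp

theorem ae_comp_neg {P : ℝ → Prop} (h : ∀ᵐ x, P x) : ∀ᵐ x : ℝ, P (-x) :=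
  (Measure.measurePreserving_neg (volume : Measure ℝ)).quasiMeasurePreserving.ae h

namespace hardyPlus

theorem ext_ae {w v : hardyPlus} (h : w =ᵐ[volume] v) : w = v := Subtype.ext (Lp.ext h)

theorem coeFn_add (w v : hardyPlus) : ⇑(w + v) =ᵐ[volume] fun x => w x + v x :=
  Lp.coeFn_add (w : Lp ℂ 2 (volume : Measure ℝ)) v

theorem coeFn_smul (c : ℂ) (w : hardyPlus) : ⇑(c • w) =ᵐ[volume] fun x => c * w x :=
  Lp.coeFn_smul c (w : Lp ℂ 2 (volume : Measure ℝ))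

/-- The analytic extension of an element of `H²₊` to the upper half-plane. -/
noncomputable def extension (w : hardyPlus) : ℂ → ℂ := w.2.choose

theorem isHardyFun (w : hardyPlus) : IsHardyFun 2 w (extension w) := w.2.choose_spec.isHardyFun

theorem extension_eq {w : hardyPlus} {f : ℝ → ℂ} {F : ℂ → ℂ} (h : IsHardyFun 2 f F)
    (hw : w =ᵐ[volume] f) {a : ℂ} (ha : 0 < a.im) : extension w a = F a :=
  ((isHardyFun w).congr_ae hw).extension_eq h ha

/-- Evaluation of elements of `H²₊`, extended analytically, at a point of the upper half-plane. -/
noncomputable def evalAt {a : ℂ} (ha : 0 < a.im) : hardyPlus →ₗ[ℂ] ℂ where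
  toFun w := extension w a
  map_add' w v := extension_eq ((isHardyFun w).add (isHardyFun v) one_le_two) (coeFn_add w v) ha
  map_smul' c w :=
    extension_eq ((isHardyFun w).multiplier_mul one_le_two (.const c)) (coeFn_smul c w) ha

theorem evalAt_apply {a : ℂ} (ha : 0 < a.im) (w : hardyPlus) : evalAt ha w = extension w a := rfl

theorem isHardyFun_multiplier_mul (m : multiplierAlgebra) (w : hardyPlus) :
    IsHardyFun 2 (fun x => m x * w x) (fun z => m z * extension w z) :=
  (isHardyFun w).multiplier_mul one_le_two m.2

theorem coeFn_multiplier_mul_toHardy (m : multiplierAlgebra) (w : hardyPlus) :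
    (isHardyFun_multiplier_mul m w).toHardy =ᵐ[volume] fun x => m x * w x :=
  (isHardyFun_multiplier_mul m w).coeFn_toHardy

/-- Multiplication by multipliers, as a representation of their algebra on `H²₊`. -/
noncomputable def mulBy : multiplierAlgebra →ₐ[ℂ] Module.End ℂ hardyPlus :=
  AlgHom.ofLinearMap
    (LinearMap.mk₂ ℂ (fun m w => (isHardyFun_multiplier_mul m w).toHardy)
      (fun m n w => ext_ae <| by
        filter_upwards [coeFn_multiplier_mul_toHardy (m + n) w, coeFn_multiplier_mul_toHardy m w,
          coeFn_multiplier_mul_toHardy n w, coeFn_add (isHardyFun_multiplier_mul m w).toHardy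
            (isHardyFun_multiplier_mul n w).toHardy] with x hmn hm hn hadd
        rw [hmn, hadd, hm, hn]
        exact add_mul ..)
      (fun c m w => ext_ae <| by
        filter_upwards [coeFn_multiplier_mul_toHardy (c • m) w, coeFn_multiplier_mul_toHardy m w,
          coeFn_smul c (isHardyFun_multiplier_mul m w).toHardy] with x hcm hm hsmul
        rw [hcm, hsmul, hm]
        exact mul_assoc ..)
      (fun m w v => ext_ae <| by
        filter_upwards [coeFn_multiplier_mul_toHardy m (w + v), coeFn_multiplier_mul_toHardy m w,
          coeFn_multiplier_mul_toHardy m v, coeFn_add (isHardyFun_multiplier_mul m w).toHardy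
            (isHardyFun_multiplier_mul m v).toHardy, coeFn_add w v] with x hwv hw hv hadd hsum
        rw [hwv, hadd, hw, hv, hsum]
        exact mul_add ..)
      (fun c m w => ext_ae <| by
        filter_upwards [coeFn_multiplier_mul_toHardy m (c • w), coeFn_multiplier_mul_toHardy m w,
          coeFn_smul c (isHardyFun_multiplier_mul m w).toHardy, coeFn_smul c w]
          with x hcw hw hsmul hcx
        rw [hcw, hsmul, hw, hcx]
        exact mul_left_comm ..))
    (LinearMap.ext fun w => ext_ae <| by
      filter_upwards [coeFn_multiplier_mul_toHardy 1 w] with x hx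
      exact hx.trans (one_mul _))
    fun m n => LinearMap.ext fun w => ext_ae <| by
      filter_upwards [coeFn_multiplier_mul_toHardy (m * n) w, coeFn_multiplier_mul_toHardy n w,
        coeFn_multiplier_mul_toHardy m (isHardyFun_multiplier_mul n w).toHardy]
        with x hmn hn hm
      exact (hmn.trans (mul_assoc ..)).trans (((congrArg (m x * ·) hn).symm).trans hm.symm)

theorem coeFn_mulBy (m : multiplierAlgebra) (w : hardyPlus) :
    ⇑(mulBy m w) =ᵐ[volume] fun x => m x * w x :=
  coeFn_multiplier_mul_toHardy m w

theorem evalAt_mulBy {a : ℂ} (ha : 0 < a.im) (m : multiplierAlgebra) (w : hardyPlus) :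
    evalAt ha (mulBy m w) = m a * evalAt ha w :=
  extension_eq (isHardyFun_multiplier_mul m w) (coeFn_mulBy m w) ha

theorem mulBy_injective {m : multiplierAlgebra} (hm : ∀ x : ℝ, m x ≠ 0) :
    Function.Injective (mulBy m) := fun w v hwv => ext_ae <| by
  filter_upwards [coeFn_mulBy m w, coeFn_mulBy m v] with x hw hv
  rw [hwv, hv] at hw
  exact (mul_left_cancel₀ (hm x) hw).symm

theorem coeFn_reflect_toHardy (w : hardyPlus) :
    (isHardyFun w).reflect.toHardy =ᵐ[volume] fun x => conj (w (-x)) :=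
  (isHardyFun w).reflect.coeFn_toHardy

/-- The antilinear involution `w(x) ↦ conj w(-x)` of `H²₊`. -/
noncomputable def reflect : hardyPlus →ₗ⋆[ℂ] hardyPlus where
  toFun w := (isHardyFun w).reflect.toHardy
  map_add' w v := ext_ae <| by
    filter_upwards [coeFn_reflect_toHardy (w + v), coeFn_reflect_toHardy w,
      coeFn_reflect_toHardy v, ae_comp_neg (coeFn_add w v),
      coeFn_add (isHardyFun w).reflect.toHardy (isHardyFun v).reflect.toHardy]
      with x hwv hw hv hsum hadd
    rw [hwv, hadd, hw, hv, hsum, map_add]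
  map_smul' c w := ext_ae <| by
    filter_upwards [coeFn_reflect_toHardy (c • w), coeFn_reflect_toHardy w,
      ae_comp_neg (coeFn_smul c w), coeFn_smul (conj c) (isHardyFun w).reflect.toHardy]
      with x hcw hw hcx hsmul
    rw [hcw, hsmul, hw, hcx, map_mul]

theorem coeFn_reflect (w : hardyPlus) : ⇑(reflect w) =ᵐ[volume] fun x => conj (w (-x)) :=
  coeFn_reflect_toHardy w

theorem evalAt_reflect {a : ℂ} (ha : 0 < a.im) (ha' : 0 < (-conj a).im) (w : hardyPlus) :
    evalAt ha (reflect w) = conj (evalAt ha' w) :=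
  extension_eq (isHardyFun w).reflect (coeFn_reflect w) ha

theorem reflect_involutive : Function.Involutive reflect := fun w => ext_ae <| by
  filter_upwards [coeFn_reflect (reflect w), ae_comp_neg (coeFn_reflect w)] with x hx hneg
  rw [hx, hneg, Complex.conj_conj, neg_neg]

theorem reflect_mulBy {m n : multiplierAlgebra} (h : ∀ x : ℝ, conj (m ((-x : ℝ) : ℂ)) = n x)
    (w : hardyPlus) : reflect (mulBy m w) = mulBy n (reflect w) := ext_ae <| by
  filter_upwards [coeFn_reflect (mulBy m w), coeFn_reflect w, ae_comp_neg (coeFn_mulBy m w),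
    coeFn_mulBy n (reflect w)] with x hmw hw hneg hnw
  rw [hmw, hnw, hw, hneg, map_mul, h]

/-- The function `(x + i)⁻¹` of `H²₊`, chosen because its extension has no zeros. -/
noncomputable def base : hardyPlus := (isHardyFun_inv_sub (β := -I) (by simp)).toHardy

theorem evalAt_base {a : ℂ} (ha : 0 < a.im) : evalAt ha base = (a - -I)⁻¹ :=
  have h := isHardyFun_inv_sub (β := -I) (by simp)
  extension_eq h h.coeFn_toHardy ha

theorem evalAt_base_ne_zero {a : ℂ} (ha : 0 < a.im) : evalAt ha base ≠ 0 := by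
  rw [evalAt_base]
  exact inv_ne_zero (sub_ne_zero_of_im_neg (by simp) ha.le)

theorem evalAt_surjective {a : ℂ} (ha : 0 < a.im) : Function.Surjective (evalAt ha) :=
  LinearMap.surjective fun h => evalAt_base_ne_zero ha (by rw [h, LinearMap.zero_apply])

end hardyPlus

/-- The multiplier `(z + i)⁻¹`. -/
noncomputable def invAddI : multiplierAlgebra :=
  ⟨fun z => (z - -I)⁻¹, isMultiplier_inv_sub (by simp)⟩

theorem add_I_ne_zero {z : ℂ} (hz : 0 ≤ z.im) : z + I ≠ 0 := by
  simpa using sub_ne_zero_of_im_neg (β := -I) (by simp) hz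

theorem invAddI_apply (z : ℂ) : invAddI z = (z + I)⁻¹ := congrArg (·⁻¹) (sub_neg_eq_add z I)

/-- The fractional linear multiplier `(z - a) / (z + i)`. It plays the role of a Blaschke factor,
with the same pole for all `a`. -/
noncomputable def mobius (a : ℂ) : multiplierAlgebra := 1 - (a + I) • invAddI

theorem mobius_apply (a : ℂ) {z : ℂ} (hz : 0 ≤ z.im) : mobius a z = (z - a) / (z + I) := by
  have hne := add_I_ne_zero hz
  change 1 - (a + I) * invAddI z = _
  rw [invAddI_apply]
  field_simp
  ring

theorem mobius_apply_self (a : ℂ) (ha : 0 ≤ a.im) : mobius a a = 0 := by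
  rw [mobius_apply a ha, sub_self, zero_div]

theorem mobius_apply_ne_zero {a z : ℂ} (hz : 0 ≤ z.im) (h : z ≠ a) : mobius a z ≠ 0 := by
  rw [mobius_apply a hz]
  exact div_ne_zero (sub_ne_zero.2 h) (add_I_ne_zero hz)

theorem mobius_apply_ofReal_ne_zero {a : ℂ} (ha : 0 < a.im) (x : ℝ) : mobius a x ≠ 0 :=
  mobius_apply_ne_zero (by simp) (sub_ne_zero.1 (ofReal_sub_ne_zero ha.ne' x))

theorem conj_mobius_neg_conj (a : ℂ) {z : ℂ} (hz : 0 ≤ z.im) :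
    conj (mobius a (-conj z)) = mobius (-conj a) z := by
  have hne : z + I ≠ 0 := add_I_ne_zero hz
  have hne' : -z - I ≠ 0 := fun h => hne (by linear_combination -h)
  rw [mobius_apply _ (by simpa), mobius_apply _ hz]
  simp only [map_div₀, map_sub, map_add, map_neg, Complex.conj_conj, Complex.conj_I,
    ← sub_eq_add_neg]
  rw [div_eq_div_iff hne' hne]
  ring

/-- The finite product `∏ₘ ((z - aₘ) / (z + i))^{oₘ}`. -/
noncomputable def blaschke {ι : Type*} [Fintype ι] (a : ι → ℂ) (o : ι → ℕ) : multiplierAlgebra :=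
  ∏ m, mobius (a m) ^ o m

section Blaschke

variable {ι : Type*} [Fintype ι] (a : ι → ℂ) (o : ι → ℕ)

theorem blaschke_apply (z : ℂ) : blaschke a o z = ∏ m, mobius (a m) z ^ o m := by
  have h := map_prod ((Pi.evalAlgHom ℂ (fun _ : ℂ => ℂ) z).comp multiplierAlgebra.val)
    (fun m => mobius (a m) ^ o m) Finset.univ
  simp only [map_pow] at h
  exact h

theorem blaschke_apply_ne_zero {z : ℂ} (hz : 0 ≤ z.im) (h : ∀ m, o m ≠ 0 → z ≠ a m) :
    blaschke a o z ≠ 0 := by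
  rw [blaschke_apply, Finset.prod_ne_zero_iff]
  intro m _
  rcases eq_or_ne (o m) 0 with hm | hm
  · simp [hm]
  · exact pow_ne_zero _ (mobius_apply_ne_zero hz (h m hm))

variable {a} in
theorem blaschke_apply_ofReal_ne_zero (ha : ∀ m, 0 < (a m).im) (x : ℝ) : blaschke a o x ≠ 0 :=
  blaschke_apply_ne_zero a o (by simp) fun m _ => sub_ne_zero.1 (ofReal_sub_ne_zero (ha m).ne' x)

theorem conj_blaschke_neg_conj {z : ℂ} (hz : 0 ≤ z.im) :
    conj (blaschke a o (-conj z)) = blaschke (fun m => -conj (a m)) o z := by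
  simp only [blaschke_apply, map_prod, map_pow, conj_mobius_neg_conj _ hz]

variable {a} in
theorem blaschke_neg_conj {σ : ι → ι} (hσ : Function.Involutive σ)
    (h : ∀ m, a (σ m) = -conj (a m)) :
    blaschke (fun m => -conj (a m)) o = blaschke a (o ∘ σ) := by
  refine Finset.prod_equiv hσ.toPerm (by simp) fun m _ => ?_
  simp only [Function.Involutive.coe_toPerm, Function.comp_apply, hσ m, h]

theorem blaschke_zero : blaschke a 0 = 1 := Finset.prod_eq_one fun m _ => pow_zero (mobius (a m))

theorem blaschke_add (o' : ι → ℕ) : blaschke a (o + o') = blaschke a o * blaschke a o' := by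
  simp only [blaschke, Pi.add_apply, pow_add, Finset.prod_mul_distrib]

variable [DecidableEq ι]

theorem blaschke_single (m : ι) (k : ℕ) : blaschke a (Pi.single m k) = mobius (a m) ^ k := by
  rw [blaschke, Finset.prod_eq_single m (fun n _ hn => by rw [Pi.single_eq_of_ne hn, pow_zero])
    (by simp), Pi.single_eq_same]

/-- The product `blaschke a o` without its `m`-th factor. -/
noncomputable def cofactor (m : ι) : multiplierAlgebra := blaschke a (Function.update o m 0)

theorem cofactor_mul_mobius_pow (m : ι) :
    cofactor a o m * mobius (a m) ^ o m = blaschke a o := by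
  rw [cofactor, ← blaschke_single, ← blaschke_add]
  congr 1
  ext n
  rcases eq_or_ne n m with rfl | hn <;> simp [*]

variable {a} in
theorem cofactor_apply_self_ne_zero (ha : Function.Injective a) {m : ι} (hm : 0 ≤ (a m).im) :
    cofactor a o m (a m) ≠ 0 := by
  refine blaschke_apply_ne_zero a _ hm fun n hn hmn => hn ?_
  rw [ha hmn, Function.update_self]

variable {a} in
theorem cofactor_add_comp_apply {σ : ι → ι} (hσ : Function.Involutive σ)
    (h : ∀ m, a (σ m) = -conj (a m)) {m : ι} (hm : σ m = m) (him : 0 ≤ (a m).im) :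
    cofactor a (o + o ∘ σ) m (a m) = (‖cofactor a o m (a m)‖ ^ 2 : ℝ) := by
  have hsplit : Function.update (o + o ∘ σ) m 0 =
      Function.update o m 0 + Function.update o m 0 ∘ σ := by
    ext n
    have hn : σ n = m ↔ n = m := by rw [hσ.eq_iff, hm]
    by_cases hnm : n = m <;> simp [hn, hnm, hm]
  have hself : -conj (a m) = a m := by rw [← h, hm]
  have hconj : conj (cofactor a o m (a m)) = blaschke a (Function.update o m 0 ∘ σ) (a m) := by
    rw [cofactor, ← blaschke_neg_conj _ hσ h, ← conj_blaschke_neg_conj _ _ him, hself]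
  rw [cofactor, hsplit, blaschke_add, Complex.ofReal_pow, ← Complex.mul_conj', hconj]
  rfl

end Blaschke

theorem induction_add_single {ι : Type*} [Finite ι] [DecidableEq ι] {P : (ι → ℕ) → Prop}
    (zero : P 0) (add_single : ∀ o m, P o → P (o + Pi.single m 1)) (o : ι → ℕ) : P o := by
  have := Fintype.ofFinite ι
  induction h : ∑ m, o m generalizing o with
  | zero =>
    obtain rfl : o = 0 := funext fun m => Finset.sum_eq_zero_iff.1 h m (Finset.mem_univ m)
    exact zero
  | succ k ih =>
    obtain ⟨m, -, hm⟩ := Finset.exists_ne_zero_of_sum_ne_zero (h.trans_ne k.succ_ne_zero)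
    obtain ⟨o', rfl⟩ : ∃ o', o = o' + Pi.single m 1 :=
      ⟨o - Pi.single m 1, (tsub_add_cancel_of_le (update_le_iff.2
        ⟨Nat.one_le_iff_ne_zero.2 hm, fun _ _ => Nat.zero_le _⟩)).symm⟩
    exact add_single o' m (ih o' (by simpa [Finset.sum_add_distrib] using h))

theorem length_quotient_range_comp {R E : Type*} [Ring R] [AddCommGroup E] [Module R E]
    {A : E →ₗ[R] E} (hA : Function.Injective A) (B : E →ₗ[R] E) :
    Module.length R (E ⧸ LinearMap.range (A ∘ₗ B)) =
      Module.length R (E ⧸ LinearMap.range B) + Module.length R (E ⧸ LinearMap.range A) := by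
  have hB : LinearMap.range B = (LinearMap.range (A ∘ₗ B)).comap A := by
    rw [LinearMap.range_comp, Submodule.comap_map_eq_of_injective hA]
  have hle : LinearMap.range (A ∘ₗ B) ≤ LinearMap.range A := LinearMap.range_comp_le_range B A
  refine Module.length_eq_add_of_exact (Submodule.mapQ _ _ A hB.le) (Submodule.factor hle)
    (LinearMap.ker_eq_bot.1 ?_) (Submodule.factor_surjective hle) ?_
  · rw [Submodule.ker_mapQ, ← hB, Submodule.mkQ_map_self]
  · rw [LinearMap.exact_iff, Submodule.factor, Submodule.ker_mapQ, Submodule.range_mapQ,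
      Submodule.comap_id]

namespace hardyPlus

theorem range_mulBy_mobius {a : ℂ} (ha : 0 < a.im) :
    LinearMap.range (mulBy (mobius a)) = LinearMap.ker (evalAt ha) := by
  ext w
  rw [LinearMap.mem_range, LinearMap.mem_ker]
  constructor
  · rintro ⟨v, rfl⟩
    rw [evalAt_mulBy, mobius_apply_self a ha.le, zero_mul]
  · intro hw
    -- `w (z + i) / (z - a) = w + (a + i) w / (z - a)`
    have hquot := (isHardyFun w).add (((isHardyFun w).div_sub one_le_two ha hw).multiplier_mul
      one_le_two (.const (a + I))) one_le_two
    refine ⟨hquot.toHardy, ext_ae ?_⟩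
    filter_upwards [coeFn_mulBy (mobius a) hquot.toHardy, hquot.coeFn_toHardy] with x hmul hx
    have hxa := ofReal_sub_ne_zero ha.ne' x
    have hxI : (x : ℂ) + I ≠ 0 := add_I_ne_zero (by simp)
    rw [hmul, hx, mobius_apply a (by simp)]
    field_simp
    ring

theorem mem_range_mulBy_mul_mobius {m : multiplierAlgebra} {a : ℂ} (ha : 0 < a.im)
    {v : hardyPlus} (hv : evalAt ha v = 0) :
    mulBy m v ∈ LinearMap.range (mulBy (m * mobius a)) := by
  obtain ⟨u, rfl⟩ : v ∈ LinearMap.range (mulBy (mobius a)) := by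
    rwa [range_mulBy_mobius ha, LinearMap.mem_ker]
  exact ⟨u, by rw [map_mul, Module.End.mul_apply]⟩

theorem length_quotient_range_mulBy_mul {m : multiplierAlgebra} (hm : ∀ x : ℝ, m x ≠ 0)
    (n : multiplierAlgebra) :
    Module.length ℂ (hardyPlus ⧸ LinearMap.range (mulBy (m * n))) =
      Module.length ℂ (hardyPlus ⧸ LinearMap.range (mulBy n)) +
        Module.length ℂ (hardyPlus ⧸ LinearMap.range (mulBy m)) := by
  rw [map_mul]
  exact length_quotient_range_comp (mulBy_injective hm) _

theorem length_quotient_range_mulBy_mobius {a : ℂ} (ha : 0 < a.im) :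
    Module.length ℂ (hardyPlus ⧸ LinearMap.range (mulBy (mobius a))) = 1 := by
  rw [range_mulBy_mobius ha,
    ((evalAt ha).quotKerEquivOfSurjective (evalAt_surjective ha)).length_eq, Module.length_eq_one]

theorem length_quotient_range_mulBy_blaschke {ι : Type*} [Fintype ι] {a : ι → ℂ}
    (ha : ∀ m, 0 < (a m).im) (o : ι → ℕ) :
    Module.length ℂ (hardyPlus ⧸ LinearMap.range (mulBy (blaschke a o))) = (∑ m, o m : ℕ) := by
  classical
  induction o using induction_add_single with
  | zero =>
    rw [blaschke_zero, map_one, Module.End.one_eq_id, LinearMap.range_id]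
    simp
  | add_single o m ih =>
    rw [blaschke_add, blaschke_single, pow_one,
      length_quotient_range_mulBy_mul (blaschke_apply_ofReal_ne_zero o ha),
      length_quotient_range_mulBy_mobius (ha m), ih, add_comm]
    simp [Finset.sum_add_distrib]

end hardyPlus

theorem eq_zero_of_isAlt {E : Type*} [AddCommGroup E] [Module ℂ E] {B : E →ₗ[ℂ] E →ₗ⋆[ℂ] ℂ}
    (hB : B.IsAlt) : B = 0 := by
  ext x y
  have h := hB.neg x y
  have hI := hB.neg x (I • y)
  simp only [map_smulₛₗ, Complex.conj_I, LinearMap.smul_apply, smul_eq_mul, RingHom.id_apply] at hI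
  refine (mul_eq_zero_iff_left (mul_ne_zero two_ne_zero Complex.I_ne_zero)).1
    (?_ : 2 * I * B x y = 0)
  linear_combination hI - I * h

open hardyPlus

section HankelForm

variable {φ : ℝ → ℂ}

theorem integrable_symbol_mul (hφ : MemLp φ ∞) (w u : hardyPlus) :
    Integrable fun x => φ (-x) * (w x * u x) := by
  have hneg : MemLp (fun x => φ (-x)) ∞ :=
    hφ.comp_measurePreserving (Measure.measurePreserving_neg volume)
  exact memLp_one_iff_integrable.1 (((isHardyFun w).mul le_rfl (isHardyFun u)).memLp.mul hneg)

/-- The bilinear form `(w, u) ↦ ∫ φ(-x) w(x) u(x) dx` on the Hardy space. -/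
noncomputable def hankelForm (hφ : MemLp φ ∞) : hardyPlus →ₗ[ℂ] hardyPlus →ₗ[ℂ] ℂ :=
  LinearMap.mk₂ ℂ (fun w u => ∫ x, φ (-x) * (w x * u x))
    (fun w v u => by
      rw [← integral_add (integrable_symbol_mul hφ w u) (integrable_symbol_mul hφ v u)]
      refine integral_congr_ae ?_
      filter_upwards [coeFn_add w v] with x hx
      rw [hx]
      ring)
    (fun c w u => by
      rw [smul_eq_mul, ← integral_const_mul]
      refine integral_congr_ae ?_
      filter_upwards [coeFn_smul c w] with x hx
      rw [hx]
      ring)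
    (fun w u v => by
      rw [← integral_add (integrable_symbol_mul hφ w u) (integrable_symbol_mul hφ w v)]
      refine integral_congr_ae ?_
      filter_upwards [coeFn_add u v] with x hx
      rw [hx]
      ring)
    (fun c w u => by
      rw [smul_eq_mul, ← integral_const_mul]
      refine integral_congr_ae ?_
      filter_upwards [coeFn_smul c u] with x hx
      rw [hx]
      ring)

variable (hφ : MemLp φ ∞)

theorem hankelForm_apply (w u : hardyPlus) :
    hankelForm hφ w u = ∫ x, φ (-x) * (w x * u x) := rfl

theorem hankelForm_mulBy_right (m : multiplierAlgebra) (w u : hardyPlus) :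
    hankelForm hφ w (mulBy m u) = hankelForm hφ (mulBy m w) u := by
  refine integral_congr_ae ?_
  filter_upwards [coeFn_mulBy m w, coeFn_mulBy m u] with x hw hu
  rw [hw, hu]
  ring

theorem IsHankelWithSymbol.inner_eq {H : hardyPlus →L[ℂ] hardyPlus}
    (hH : IsHankelWithSymbol φ H) (w v : hardyPlus) :
    inner ℂ v (H w) = hankelForm hH.symbol_bounded w (reflect v) := by
  let B : hardyPlus →ₗ[ℂ] hardyPlus →ₗ⋆[ℂ] ℂ :=
    (innerₛₗ ℂ).flip ∘ₗ (H : hardyPlus →ₗ[ℂ] hardyPlus)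
  let C : hardyPlus →ₗ[ℂ] hardyPlus →ₗ⋆[ℂ] ℂ := (hankelForm hH.symbol_bounded).compl₂ reflect
  suffices h : (B - C).IsAlt from
    sub_eq_zero.1 (LinearMap.congr_fun₂ (eq_zero_of_isAlt h) w v)
  intro w
  change inner ℂ w (H w) - hankelForm hH.symbol_bounded w (reflect w) = 0
  rw [sub_eq_zero, hH.form_eq, hankelForm_apply, ← integral_neg_eq_self]
  refine integral_congr_ae ?_
  filter_upwards [coeFn_reflect w] with x hx
  rw [hx, neg_neg, mul_assoc]

theorem IsHankelWithSymbol.ker_eq {H : hardyPlus →L[ℂ] hardyPlus}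
    (hH : IsHankelWithSymbol φ H) :
    LinearMap.ker (H : hardyPlus →ₗ[ℂ] hardyPlus) =
      LinearMap.ker (hankelForm hH.symbol_bounded) := by
  ext w
  rw [LinearMap.mem_ker, LinearMap.mem_ker, LinearMap.ext_iff,
    reflect_involutive.surjective.forall]
  refine ⟨fun hw v => ?_, fun hw => ext_inner_left ℂ fun v => ?_⟩
  · rw [← hH.inner_eq, show H w = 0 from hw, inner_zero_right, LinearMap.zero_apply]
  · rw [inner_zero_right]
    exact (hH.inner_eq w v).trans (hw v)

end HankelForm

/-- `φ(-x) = ∑ₘ φₘ(x)`, where `φₘ = qₘ / (mobius (a m) ^ Kₘ * (z - aₘ))` has a pole of order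
exactly `Kₘ + 1` at `aₘ` and no other singularity in the closed upper half-plane. -/
structure IsPolarSymbol {ι : Type*} [Fintype ι] (φ : ℝ → ℂ) (a : ι → ℂ) (K : ι → ℕ)
    (q : ι → multiplierAlgebra) : Prop where
  im_pos : ∀ m, 0 < (a m).im
  injective : Function.Injective a
  ne_zero : ∀ m, q m (a m) ≠ 0
  symbol_neg : ∀ x : ℝ, φ (-x) = ∑ m, q m x / (mobius (a m) x ^ K m * (x - a m))

/-- The factor `2πi qₘ(aₘ)` with which the top-order part of the `m`-th pole enters the Hankel
form. -/
noncomputable def poleWeight {ι : Type*} (a : ι → ℂ) (q : ι → multiplierAlgebra) (m : ι) : ℂ :=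
  2 * Real.pi * I * q m (a m)

namespace IsPolarSymbol

variable {ι : Type*} [Fintype ι] {φ : ℝ → ℂ} {a : ι → ℂ} {K : ι → ℕ}
  {q : ι → multiplierAlgebra} (h : IsPolarSymbol φ a K q) (hφ : MemLp φ ∞)

include h

theorem poleWeight_ne_zero (m : ι) : poleWeight a q m ≠ 0 :=
  mul_ne_zero Complex.two_pi_I_ne_zero (h.ne_zero m)

variable [DecidableEq ι]

theorem symbol_neg_mul_blaschke {o : ι → ℕ} (ho : K ≤ o) (x : ℝ) :
    φ (-x) * blaschke a o x =
      ∑ m, (q m * cofactor a o m * mobius (a m) ^ (o m - K m)) x / (x - a m) := by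
  rw [h.symbol_neg, Finset.sum_mul]
  refine Finset.sum_congr rfl fun m _ => ?_
  have hx := mobius_apply_ofReal_ne_zero (h.im_pos m) x
  have hfactor : blaschke a o x =
      cofactor a o m x * (mobius (a m) x ^ K m * mobius (a m) x ^ (o m - K m)) := by
    rw [← cofactor_mul_mobius_pow a o m, ← pow_add, Nat.add_sub_cancel' (ho m)]
    rfl
  have happly : (q m * cofactor a o m * mobius (a m) ^ (o m - K m)) x =
      q m x * cofactor a o m x * mobius (a m) x ^ (o m - K m) := rfl
  rw [hfactor, happly]
  field_simp

theorem hankelForm_mulBy_blaschke {o : ι → ℕ} (ho : K ≤ o) (w u : hardyPlus) :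
    hankelForm hφ (mulBy (blaschke a o) w) u = ∑ m with o m = K m,
      poleWeight a q m * cofactor a o m (a m) *
        (evalAt (h.im_pos m) w * evalAt (h.im_pos m) u) := by
  let n (m : ι) : multiplierAlgebra := q m * cofactor a o m * mobius (a m) ^ (o m - K m)
  have hHardy (m : ι) : IsHardyFun 1 (fun x => n m x * (w x * u x))
      (fun z => n m z * (extension w z * extension u z)) :=
    ((isHardyFun w).mul le_rfl (isHardyFun u)).multiplier_mul le_rfl (n m).2
  have hint (m : ι) : Integrable fun x : ℝ => n m x * (w x * u x) / (x - a m) :=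
    integrable_div_sub (memLp_one_iff_integrable.1 (hHardy m).memLp) (h.im_pos m).ne'
  calc hankelForm hφ (mulBy (blaschke a o) w) u
      = ∫ x : ℝ, ∑ m, n m x * (w x * u x) / (x - a m) := by
        refine integral_congr_ae ?_
        filter_upwards [coeFn_mulBy (blaschke a o) w] with x hx
        rw [hx, mul_assoc, ← mul_assoc (φ (-x)), h.symbol_neg_mul_blaschke ho, Finset.sum_mul]
        exact Finset.sum_congr rfl fun m _ => div_mul_eq_mul_div _ _ _
    _ = ∑ m, 2 * Real.pi * I * (n m (a m) * (extension w (a m) * extension u (a m))) := by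
        rw [integral_finsetSum _ fun m _ => hint m]
        exact Finset.sum_congr rfl fun m _ => (hHardy m).integral_div_sub (h.im_pos m)
    _ = _ := by
        rw [Finset.sum_filter]
        refine Finset.sum_congr rfl fun m _ => ?_
        have happly : n m (a m) = q m (a m) * cofactor a o m (a m) *
          mobius (a m) (a m) ^ (o m - K m) := rfl
        rw [happly, mobius_apply_self _ (h.im_pos m).le, evalAt_apply, evalAt_apply, poleWeight]
        split_ifs with hm
        · rw [hm, Nat.sub_self, pow_zero]
          ring
        · rw [zero_pow (Nat.sub_ne_zero_of_lt ((ho m).lt_of_ne' hm))]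
          ring

omit [DecidableEq ι] in
theorem hankelForm_mulBy_blaschke_add_one (w u : hardyPlus) :
    hankelForm hφ (mulBy (blaschke a (K + 1)) w) u = 0 := by
  classical
  rw [h.hankelForm_mulBy_blaschke hφ le_self_add, Finset.filter_false_of_mem,
    Finset.sum_empty]
  exact fun m _ => (Nat.lt_succ_self _).ne'

theorem hankelForm_mulBy_blaschke_update {o : ι → ℕ} (ho : ∀ m, K m < o m) (m : ι)
    (w u : hardyPlus) :
    hankelForm hφ (mulBy (blaschke a (Function.update o m (K m))) w) u =
      poleWeight a q m * cofactor a o m (a m) *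
        (evalAt (h.im_pos m) w * evalAt (h.im_pos m) u) := by
  have hfilter : ({n | Function.update o m (K m) n = K n} : Finset ι) = {m} := by
    ext n
    rcases eq_or_ne n m with rfl | hn <;> simp [*, (ho n).ne']
  rw [h.hankelForm_mulBy_blaschke hφ (le_update_iff.2 ⟨le_rfl, fun n _ => (ho n).le⟩), hfilter,
    Finset.sum_singleton, cofactor, cofactor, Function.update_idem]

theorem evalAt_eq_zero_of_mem_ker {o : ι → ℕ} {m : ι} (ho : o + Pi.single m 1 ≤ K + 1)
    {v : hardyPlus} (hv : mulBy (blaschke a o) v ∈ LinearMap.ker (hankelForm hφ)) :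
    evalAt (h.im_pos m) v = 0 := by
  have hle : o ≤ Function.update (K + 1) m (K m) := by
    refine le_update_iff.2 ⟨?_, fun n _ => le_self_add.trans (ho n)⟩
    simpa using ho m
  obtain ⟨e, he⟩ := exists_add_of_le hle
  have hzero : poleWeight a q m * cofactor a (K + 1) m (a m) *
      (evalAt (h.im_pos m) v * evalAt (h.im_pos m) base) = 0 := by
    rw [← h.hankelForm_mulBy_blaschke_update hφ (o := K + 1) fun n => Nat.lt_succ_self _, he,
      add_comm, blaschke_add, map_mul, Module.End.mul_apply, ← hankelForm_mulBy_right,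
      LinearMap.mem_ker.1 hv, LinearMap.zero_apply]
  simpa [h.poleWeight_ne_zero, cofactor_apply_self_ne_zero _ h.injective (h.im_pos m).le,
    evalAt_base_ne_zero] using hzero

omit [DecidableEq ι] in
theorem ker_hankelForm :
    LinearMap.ker (hankelForm hφ) = LinearMap.range (mulBy (blaschke a (K + 1))) := by
  classical
  refine le_antisymm ?_ ?_
  · suffices hle : ∀ o ≤ K + 1, LinearMap.ker (hankelForm hφ) ≤
        LinearMap.range (mulBy (blaschke a o)) from hle _ le_rfl
    intro o
    induction o using induction_add_single with
    | zero => simp [blaschke_zero, Module.End.one_eq_id]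
    | add_single o m ih =>
      intro ho w hw
      obtain ⟨v, rfl⟩ := ih (le_self_add.trans ho) hw
      rw [blaschke_add, blaschke_single, pow_one]
      exact mem_range_mulBy_mul_mobius (h.im_pos m) (h.evalAt_eq_zero_of_mem_ker hφ ho hw)
  · rintro _ ⟨w, rfl⟩
    exact LinearMap.ext fun u => h.hankelForm_mulBy_blaschke_add_one hφ w u

end IsPolarSymbol

namespace hardyPlus

theorem evalAt_reflect_self {a : ℂ} (ha : 0 < a.im) (hself : -conj a = a) (w : hardyPlus) :
    evalAt ha (reflect w) = conj (evalAt ha w) := by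
  rw [evalAt_reflect ha (hself.symm ▸ ha), evalAt_apply, evalAt_apply, hself]

theorem reflect_mulBy_blaschke {ι : Type*} [Fintype ι] (a : ι → ℂ) (o : ι → ℕ) (w : hardyPlus) :
    reflect (mulBy (blaschke a o) w) = mulBy (blaschke (fun m => -conj (a m)) o) (reflect w) := by
  refine reflect_mulBy (fun x => ?_) w
  rw [← conj_blaschke_neg_conj a o (z := x) (by simp), Complex.conj_ofReal, Complex.ofReal_neg]

end hardyPlus

/-- The involution `σ` matches each pole with a pole of the same order at the mirror image with
respect to the imaginary axis. -/
structure IsPoleReflection {ι : Type*} (a : ι → ℂ) (K : ι → ℕ) (σ : ι → ι) : Prop where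
  involutive : Function.Involutive σ
  pole : ∀ m, a (σ m) = -conj (a m)
  order : ∀ m, K (σ m) = K m

namespace IsPolarSymbol

variable {ι : Type*} [Fintype ι] {φ : ℝ → ℂ} {a : ι → ℂ} {K : ι → ℕ}
  {q : ι → multiplierAlgebra} {σ : ι → ι} (h : IsPolarSymbol φ a K q) {hφ : MemLp φ ∞}
  (hsymm : ∀ w v, hankelForm hφ w (reflect v) = conj (hankelForm hφ v (reflect w)))

include hsymm in
theorem hankelForm_mulBy_blaschke_reflect (hσ : Function.Involutive σ)
    (haσ : ∀ m, a (σ m) = -conj (a m)) (o : ι → ℕ) (w v : hardyPlus) :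
    hankelForm hφ (mulBy (blaschke a o) w) (reflect v) =
      conj (hankelForm hφ (mulBy (blaschke a (o ∘ σ)) v) (reflect w)) := by
  rw [hsymm, reflect_mulBy_blaschke, blaschke_neg_conj o hσ haσ, hankelForm_mulBy_right]

include h hsymm

theorem exists_eq_neg_conj (m : ι) : ∃ n, a n = -conj (a m) := by
  classical
  by_contra! hne
  have hm := h.im_pos m
  have hm' : 0 < (-conj (a m)).im := by simpa using hm
  have hzero : poleWeight a q m * cofactor a (K + 1) m (a m) *
      (evalAt hm base * evalAt hm (reflect (mulBy (blaschke a (K + 1)) base))) = 0 := by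
    rw [← h.hankelForm_mulBy_blaschke_update hφ (o := K + 1) fun n => Nat.lt_succ_self _, hsymm,
      h.hankelForm_mulBy_blaschke_add_one, map_zero]
  rw [evalAt_reflect hm hm', evalAt_mulBy] at hzero
  have hblaschke := blaschke_apply_ne_zero a (K + 1) hm'.le fun n _ => (hne n).symm
  simp [h.poleWeight_ne_zero, cofactor_apply_self_ne_zero _ h.injective hm.le,
    evalAt_base_ne_zero, hblaschke] at hzero

theorem order_le_order_reflection (hσ : Function.Involutive σ)
    (haσ : ∀ m, a (σ m) = -conj (a m)) (m : ι) : K m ≤ K (σ m) := by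
  classical
  by_contra! hlt
  have hm := h.im_pos m
  have hm' : 0 < (-conj (a m)).im := by simpa using hm
  set o : ι → ℕ := K + 1 + K ∘ σ with ho
  have hother (n : ι) : K n < (Function.update o m (K m) ∘ σ) n := by
    rcases eq_or_ne (σ n) m with rfl | hn
    · simpa [hσ n] using hlt
    · simp [ho, hn, hσ n]
  have hzero : poleWeight a q m * cofactor a o m (a m) *
      (evalAt hm base * evalAt hm (reflect base)) = 0 := by
    rw [← h.hankelForm_mulBy_blaschke_update hφ fun n => by simp [ho]; omega,
      hankelForm_mulBy_blaschke_reflect hsymm hσ haσ, h.hankelForm_mulBy_blaschke hφ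
        fun n => (hother n).le, Finset.filter_false_of_mem fun n _ => (hother n).ne',
      Finset.sum_empty, map_zero]
  rw [evalAt_reflect hm hm'] at hzero
  simp [h.poleWeight_ne_zero, cofactor_apply_self_ne_zero _ h.injective hm.le,
    evalAt_base_ne_zero] at hzero

theorem exists_isPoleReflection : ∃ σ, IsPoleReflection a K σ := by
  choose σ haσ using h.exists_eq_neg_conj hsymm
  have hσ : Function.Involutive σ := fun m => h.injective (by simp [haσ])
  have hle := h.order_le_order_reflection hsymm hσ haσ
  exact ⟨σ, hσ, haσ, fun m => le_antisymm (by simpa [hσ m] using hle (σ m)) (hle m)⟩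

theorem poleWeight_im_eq_zero (hσ : IsPoleReflection a K σ) {m : ι} (hm : σ m = m) :
    (poleWeight a q m).im = 0 := by
  classical
  have him := h.im_pos m
  have hself : -conj (a m) = a m := by rw [← hσ.pole, hm]
  set o : ι → ℕ := Function.update (K + 1 + (K + 1) ∘ σ) m (K m) with ho
  have hoσ : o ∘ σ = o := by
    ext n
    have hn : σ n = m ↔ n = m := by rw [hσ.involutive.eq_iff, hm]
    by_cases hnm : n = m <;> simp [ho, hn, hnm, hm, hσ.involutive n, add_comm]
  have hform : hankelForm hφ (mulBy (blaschke a o) base) (reflect base) = poleWeight a q m *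
      (‖cofactor a (K + 1) m (a m)‖ ^ 2 * ‖evalAt him base‖ ^ 2 : ℝ) := by
    rw [h.hankelForm_mulBy_blaschke_update hφ fun n => by simp; omega,
      cofactor_add_comp_apply _ hσ.involutive hσ.pole hm him.le, evalAt_reflect_self him hself,
      Complex.mul_conj', mul_assoc]
    push_cast
    rfl
  have hconj := hankelForm_mulBy_blaschke_reflect hsymm hσ.involutive hσ.pole o base base
  rw [hoσ, hform, map_mul, Complex.conj_ofReal] at hconj
  refine Complex.conj_eq_iff_im.1 (mul_right_cancel₀ ?_ hconj).symm
  simp [cofactor_apply_self_ne_zero _ h.injective him.le, evalAt_base_ne_zero]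

omit hsymm in
theorem hankelForm_mulBy_blaschke_self [DecidableEq ι] (hσ : IsPoleReflection a K σ)
    {o : ι → ℕ} (ho : K ≤ o + o ∘ σ) (hfix : ∀ m, o m + o (σ m) = K m → σ m = m) (w : hardyPlus) :
    hankelForm hφ (mulBy (blaschke a o) w) (reflect (mulBy (blaschke a o) w)) =
      ∑ m with o m + o (σ m) = K m, poleWeight a q m *
        (‖cofactor a o m (a m)‖ ^ 2 * ‖evalAt (h.im_pos m) w‖ ^ 2 : ℝ) := by
  rw [reflect_mulBy_blaschke, blaschke_neg_conj o hσ.involutive hσ.pole, hankelForm_mulBy_right,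
    ← Module.End.mul_apply, ← map_mul, ← blaschke_add, add_comm, h.hankelForm_mulBy_blaschke hφ ho]
  refine Finset.sum_congr rfl fun m hm => ?_
  have hm := hfix m (Finset.mem_filter.1 hm).2
  rw [cofactor_add_comp_apply _ hσ.involutive hσ.pole hm (h.im_pos m).le,
    evalAt_reflect_self _ (by rw [← hσ.pole, hm]), Complex.mul_conj', mul_assoc]
  push_cast
  rfl

end IsPolarSymbol

section EigenvalueCount

theorem summable_enat {ι : Type*} (f : ι → ℕ∞) : Summable f :=
  ⟨_, hasSum_of_isLUB _ (isLUB_sSup _)⟩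

theorem eigenvalueCount_eq_tsum_length {E : Type*} [AddCommGroup E] [Module ℂ E]
    (T : Module.End ℂ E) (S : Set ℝ) :
    eigenvalueCount T S = ∑' μ : S, Module.length ℂ (T.eigenspace ((μ : ℝ) : ℂ)) :=
  tsum_congr fun _ => (Module.length_eq_rank _ _).symm

theorem eigenvalueCount_restrict_le {E : Type*} [AddCommGroup E] [Module ℂ E]
    {T : Module.End ℂ E} {V : Submodule ℂ E} (hV : Set.MapsTo T V V) (S : Set ℝ) :
    eigenvalueCount (T.restrict hV) S ≤ eigenvalueCount T S := by
  simp only [eigenvalueCount_eq_tsum_length]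
  refine (summable_enat _).tsum_le_tsum (fun μ => ?_) (summable_enat _)
  rw [(Submodule.equivMapOfInjective V.subtype V.injective_subtype _).length_eq]
  exact Module.length_le_of_injective _
    (Submodule.inclusion_injective (T.eigenspace_restrict_le_eigenspace hV _))

variable {E : Type*} [NormedAddCommGroup E] [InnerProductSpace ℂ E] {T : E →ₗ[ℂ] E}
  (hT : T.IsSymmetric)

include hT

theorem re_inner_map_sum_eigenvectors {ι : Type*} [Fintype ι] {μ : ι → ℝ}
    (hμ : Function.Injective μ) (l : ∀ i, Module.End.eigenspace T (μ i : ℂ)) :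
    (inner ℂ (∑ i, (l i : E)) (T (∑ i, (l i : E)))).re = ∑ i, μ i * ‖l i‖ ^ 2 := by
  have horth := hT.orthogonalFamily_eigenspaces.comp (Complex.ofReal_injective.comp hμ)
  have hmap : T (∑ i, (l i : E)) = ∑ i, (((μ i : ℂ) • l i : _) : E) := by
    rw [map_sum]
    exact Finset.sum_congr rfl fun i _ => Module.End.mem_eigenspace_iff.1 (l i).2
  have hinner := horth.inner_sum l (fun i => (μ i : ℂ) • l i) Finset.univ
  simp only [Submodule.coe_subtypeₗᵢ, Submodule.subtype_apply, Function.comp_apply] at hinner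
  rw [hmap, hinner, Complex.re_sum]
  refine Finset.sum_congr rfl fun i _ => ?_
  rw [inner_smul_right, inner_self_eq_norm_sq_to_K, Complex.re_ofReal_mul]
  norm_cast

theorem eq_zero_of_sum_eigenvectors_mem {ι : Type*} [Fintype ι] {μ : ι → ℝ}
    (hμ : Function.Injective μ) {ε : ℝ} (hneg : ∀ i, ε * μ i < 0) {X : Submodule ℂ E}
    (hX : ∀ x ∈ X, 0 ≤ ε * (inner ℂ x (T x)).re) {l : ∀ i, Module.End.eigenspace T (μ i : ℂ)}
    (hl : ∑ i, (l i : E) ∈ X) : l = 0 := by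
  have hterm (i : ι) : ε * (μ i * ‖l i‖ ^ 2) ≤ 0 := by
    rw [← mul_assoc]
    exact mul_nonpos_of_nonpos_of_nonneg (hneg i).le (sq_nonneg _)
  have hsum := hX _ hl
  rw [re_inner_map_sum_eigenvectors hT hμ, Finset.mul_sum] at hsum
  have hzero := (Finset.sum_eq_zero_iff_of_nonpos fun i _ => hterm i).1
    (le_antisymm (Finset.sum_nonpos fun i _ => hterm i) hsum)
  funext i
  simpa [← mul_assoc, (hneg i).ne] using hzero i (Finset.mem_univ i)

theorem sum_length_eigenspace_le {ι : Type*} [Fintype ι] {μ : ι → ℝ}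
    (hμ : Function.Injective μ) {ε : ℝ} (hneg : ∀ i, ε * μ i < 0) {X : Submodule ℂ E}
    (hX : ∀ x ∈ X, 0 ≤ ε * (inner ℂ x (T x)).re) :
    ∑ i, Module.length ℂ (Module.End.eigenspace T (μ i : ℂ)) ≤ Module.length ℂ (E ⧸ X) := by
  rw [← Module.length_pi_of_fintype]
  refine Module.length_le_of_injective (X.mkQ ∘ₗ ∑ i,
    (Module.End.eigenspace T (μ i : ℂ)).subtype ∘ₗ LinearMap.proj i) ?_
  rw [← LinearMap.ker_eq_bot, LinearMap.ker_eq_bot']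
  intro l hl
  refine eq_zero_of_sum_eigenvectors_mem hT hμ hneg hX ?_
  simpa using! (Submodule.Quotient.mk_eq_zero X).1 hl

theorem eigenvalueCount_le_length_quotient {S : Set ℝ} {ε : ℝ} (hS : ∀ μ ∈ S, ε * μ < 0)
    {X : Submodule ℂ E} (hX : ∀ x ∈ X, 0 ≤ ε * (inner ℂ x (T x)).re) :
    eigenvalueCount T S ≤ Module.length ℂ (E ⧸ X) := by
  rw [eigenvalueCount_eq_tsum_length]
  refine (summable_enat _).tsum_le_of_sum_le fun s => ?_
  rw [← Finset.sum_coe_sort]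
  exact sum_length_eigenspace_le hT (μ := fun μ : s => ((μ : S) : ℝ))
    (Subtype.val_injective.comp Subtype.val_injective) (fun μ => hS _ μ.1.2) hX

theorem card_eigenvalues_le_eigenvalueCount [FiniteDimensional ℂ E] {n : ℕ}
    (hn : Module.finrank ℂ E = n) (S : Set ℝ) [DecidablePred (· ∈ S)] :
    (({i | hT.eigenvalues hn i ∈ S} : Finset (Fin n)).card : ℕ∞) ≤ eigenvalueCount T S := by
  set A : Finset (Fin n) := {i | hT.eigenvalues hn i ∈ S} with hA
  have hAS : ∀ μ ∈ A.image (hT.eigenvalues hn), μ ∈ S := by simp [hA]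
  have hfiber (μ : ℝ) : ((A.filter fun i => hT.eigenvalues hn i = μ).card : ℕ∞) ≤
      Module.length ℂ (Module.End.eigenspace T (μ : ℂ)) := by
    rw [Module.length_eq_finrank, ← hT.card_filter_eigenvalues_eq hn, Nat.cast_le]
    refine Finset.card_le_card fun i hi => ?_
    simp [(Finset.mem_filter.1 hi).2]
  rw [Finset.card_eq_sum_card_image (hT.eigenvalues hn) A, Nat.cast_sum,
    eigenvalueCount_eq_tsum_length]
  refine (Finset.sum_le_sum fun μ _ => hfiber μ).trans ?_
  rw [← Finset.sum_subtype_of_mem (fun μ : ℝ => Module.length ℂ (Module.End.eigenspace T (μ : ℂ)))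
    hAS]
  exact (summable_enat _).sum_le_tsum _ fun _ _ => zero_le

theorem finrank_le_eigenvalueCount_add [FiniteDimensional ℂ E] (hinj : Function.Injective T) :
    (Module.finrank ℂ E : ℕ∞) ≤ eigenvalueCount T (Set.Ioi 0) + eigenvalueCount T (Set.Iio 0) := by
  classical
  obtain ⟨n, hn⟩ : ∃ n, Module.finrank ℂ E = n := ⟨_, rfl⟩
  have hne (i : Fin n) : hT.eigenvalues hn i ≠ 0 := fun h0 => by
    have heig := hT.apply_eigenvectorBasis hn i
    rw [h0, RCLike.ofReal_zero, zero_smul, ← map_zero T] at heig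
    exact (hT.eigenvectorBasis hn).orthonormal.ne_zero i (hinj heig)
  have hcover : (Finset.univ : Finset (Fin n)) =
      ({i | hT.eigenvalues hn i ∈ Set.Ioi 0} : Finset _) ∪
      ({i | hT.eigenvalues hn i ∈ Set.Iio 0} : Finset _) := by
    ext i
    simpa using (hne i).lt_or_gt.symm
  calc (Module.finrank ℂ E : ℕ∞) = (Finset.univ : Finset (Fin n)).card := by simp [hn]
    _ ≤ _ := by
      exact_mod_cast (congrArg Finset.card hcover).trans_le (Finset.card_union_le _ _)
    _ ≤ _ := add_le_add (card_eigenvalues_le_eigenvalueCount hT hn _)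
      (card_eigenvalues_le_eigenvalueCount hT hn _)

theorem length_quotient_ker_le_eigenvalueCount_add
    (hfin : Module.length ℂ (E ⧸ LinearMap.ker T) ≠ ⊤) :
    Module.length ℂ (E ⧸ LinearMap.ker T) ≤
      eigenvalueCount T (Set.Ioi 0) + eigenvalueCount T (Set.Iio 0) := by
  have hV : Set.MapsTo T (LinearMap.range T) (LinearMap.range T) := fun x _ => ⟨x, rfl⟩
  rw [T.quotKerEquivRange.length_eq] at hfin ⊢
  have : FiniteDimensional ℂ (LinearMap.range T) :=
    have := (isFiniteLength_iff_isNoetherian_isArtinian.1 (Module.length_ne_top_iff.1 hfin)).1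
    inferInstance
  have hinj : Function.Injective (T.restrict hV) := by
    rw [← LinearMap.ker_eq_bot, LinearMap.ker_eq_bot']
    rintro ⟨_, y, rfl⟩ hy
    have hTT : T (T y) = 0 := congrArg Subtype.val hy
    refine Subtype.ext (show T y = 0 from (inner_self_eq_zero (𝕜 := ℂ)).1 ?_)
    rw [hT, hTT, inner_zero_right]
  rw [Module.length_eq_finrank]
  exact (finrank_le_eigenvalueCount_add (hT.restrict_invariant hV) hinj).trans
    (add_le_add (eigenvalueCount_restrict_le hV _) (eigenvalueCount_restrict_le hV _))

theorem numEigenvalues_eq_of_semidefinite {X Y : Submodule ℂ E} {k l : ℕ}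
    (hX : ∀ x ∈ X, (inner ℂ x (T x)).re ≤ 0) (hXcodim : Module.length ℂ (E ⧸ X) = k)
    (hY : ∀ y ∈ Y, 0 ≤ (inner ℂ y (T y)).re) (hYcodim : Module.length ℂ (E ⧸ Y) = l)
    (hker : Module.length ℂ (E ⧸ LinearMap.ker T) = (k + l : ℕ)) :
    numPosEigenvalues T = k ∧ numNegEigenvalues T = l := by
  have hpos : numPosEigenvalues T ≤ k := hXcodim ▸
    eigenvalueCount_le_length_quotient hT (ε := -1) (by simp) (by simpa using hX)
  have hneg : numNegEigenvalues T ≤ l := hYcodim ▸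
    eigenvalueCount_le_length_quotient hT (ε := 1) (by simp) (by simpa using hY)
  have htotal : ((k + l : ℕ) : ℕ∞) ≤ numPosEigenvalues T + numNegEigenvalues T := hker ▸
    length_quotient_ker_le_eigenvalueCount_add hT (hker ▸ ENat.natCast_ne_top _)
  lift numPosEigenvalues T to ℕ using ne_top_of_le_ne_top (ENat.natCast_ne_top _) hpos with p
  lift numNegEigenvalues T to ℕ using ne_top_of_le_ne_top (ENat.natCast_ne_top _) hneg with n
  norm_cast at *
  omega

end EigenvalueCount

section Counting

theorem realTermPos_add_realTermNeg (K : ℕ) {p : ℝ} (hp : p ≠ 0) :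
    realTermPos K p + realTermNeg K p = K + 1 := by
  unfold realTermPos realTermNeg
  rcases hp.lt_or_gt with h | h <;> simp only [h, h.not_gt, if_true, if_false] <;>
    split_ifs <;> grind

theorem le_two_mul_realTermNeg (K : ℕ) (p : ℝ) : K ≤ 2 * realTermNeg K p := by
  unfold realTermNeg
  split_ifs <;> grind

theorem nonneg_of_two_mul_realTermNeg_eq {K : ℕ} {p : ℝ} (h : 2 * realTermNeg K p = K) :
    0 ≤ p := by
  unfold realTermNeg at h
  split_ifs at h <;> grind

theorem realTermNeg_neg (K : ℕ) (p : ℝ) : realTermNeg K (-p) = realTermPos K p := by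
  simp only [realTermPos, realTermNeg, Left.neg_neg_iff]

theorem realTerm_mul {K : ℕ} {t : ℝ} (ht : Even K → 0 < t) (p : ℝ) :
    realTermPos K (t * p) = realTermPos K p ∧ realTermNeg K (t * p) = realTermNeg K p := by
  rcases K.even_or_odd with hK | hK
  · have hneg : t * p < 0 ↔ p < 0 := smul_neg_iff_of_pos_left (ht hK)
    simp only [realTermPos, realTermNeg, mul_pos_iff_of_pos_left (ht hK), hneg, and_self]
  · simp only [realTermPos, realTermNeg, hK, if_true, and_self]

variable {ι : Type*} {a : ι → ℂ} {K : ι → ℕ}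

/-- The orders of the zeros imposed at the poles `a m` to make the Hankel form semidefinite: of
two poles symmetric about the imaginary axis only the left one gets a zero, of full order
`K m + 1`, and the orders at the poles on the axis are prescribed by `r`. -/
noncomputable def vanishingOrder (a : ι → ℂ) (K r : ι → ℕ) (m : ι) : ℕ :=
  if (a m).re = 0 then r m else if (a m).re < 0 then K m + 1 else 0

theorem sum_vanishingOrder [Fintype ι] (r : ι → ℕ) :
    ∑ m, vanishingOrder a K r m =
      ∑ m with (a m).re = 0, r m + ∑ m with (a m).re < 0, (K m + 1) := by
  rw [Finset.sum_filter, Finset.sum_filter, ← Finset.sum_add_distrib]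
  refine Finset.sum_congr rfl fun m _ => ?_
  unfold vanishingOrder
  split_ifs <;> grind

namespace IsPoleReflection

variable {σ : ι → ι} (hσ : IsPoleReflection a K σ)

include hσ

theorem re_reflection (m : ι) : (a (σ m)).re = -(a m).re := by simp [hσ.pole]

theorem reflection_eq_self_iff (ha : Function.Injective a) {m : ι} :
    σ m = m ↔ (a m).re = 0 := by
  rw [← ha.eq_iff, hσ.pole, Complex.ext_iff]
  simp [neg_eq_iff_add_eq_zero]

theorem vanishingOrder_add_reflection (ha : Function.Injective a) (r₁ r₂ : ι → ℕ) (m : ι) :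
    vanishingOrder a K r₁ m + vanishingOrder a K r₂ (σ m) =
      if (a m).re = 0 then r₁ m + r₂ m else K m + 1 := by
  unfold vanishingOrder
  rw [hσ.re_reflection, hσ.order]
  rcases lt_trichotomy (a m).re 0 with h | h | h
  · simp [h, h.ne, h.le]
  · simp [h, (hσ.reflection_eq_self_iff ha).2 h]
  · simp [h, h.ne', h.le]

theorem sum_vanishingOrder_add_sum_vanishingOrder [Fintype ι] (ha : Function.Injective a)
    {r₁ r₂ : ι → ℕ} (hr : ∀ m, (a m).re = 0 → r₁ m + r₂ m = K m + 1) :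
    ∑ m, vanishingOrder a K r₁ m + ∑ m, vanishingOrder a K r₂ m = ∑ m, (K m + 1) := by
  rw [← Equiv.sum_comp hσ.involutive.toPerm (vanishingOrder a K r₂), ← Finset.sum_add_distrib]
  refine Finset.sum_congr rfl fun m _ => (hσ.vanishingOrder_add_reflection ha r₁ r₂ m).trans ?_
  split_ifs with h
  exacts [hr m h, rfl]

end IsPoleReflection

end Counting

theorem IsHankelWithSymbol.hankelForm_reflect_eq_conj {φ : ℝ → ℂ} {H : hardyPlus →L[ℂ] hardyPlus}
    (hH : IsHankelWithSymbol φ H) (hsa : (H : hardyPlus →ₗ[ℂ] hardyPlus).IsSymmetric)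
    (w v : hardyPlus) : hankelForm hH.symbol_bounded w (reflect v) =
      conj (hankelForm hH.symbol_bounded v (reflect w)) := by
  rw [← hH.inner_eq, ← hH.inner_eq]
  exact (hsa v w).symm.trans (inner_conj_symm _ _).symm

namespace IsPolarSymbol

variable {ι : Type*} [Fintype ι] {φ : ℝ → ℂ} {a : ι → ℂ} {K : ι → ℕ}
  {q : ι → multiplierAlgebra} (h : IsPolarSymbol φ a K q)

include h

theorem hankelForm_semidefinite (hφ : MemLp φ ∞) {σ : ι → ι} (hσ : IsPoleReflection a K σ)
    (ε : ℝ) {w : hardyPlus} (hw : w ∈ LinearMap.range (mulBy (blaschke a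
      (vanishingOrder a K fun m => realTermNeg (K m) (ε * (poleWeight a q m).re))))) :
    0 ≤ ε * (hankelForm hφ w (reflect w)).re := by
  classical
  obtain ⟨w, rfl⟩ := hw
  set o := vanishingOrder a K fun m => realTermNeg (K m) (ε * (poleWeight a q m).re)
  have ho (m : ι) : o m + o (σ m) = if (a m).re = 0 then
      2 * realTermNeg (K m) (ε * (poleWeight a q m).re) else K m + 1 := by
    rw [hσ.vanishingOrder_add_reflection h.injective, two_mul]
  have hle : K ≤ o + o ∘ σ := fun m => by
    rw [Pi.add_apply, Function.comp_apply, ho]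
    split_ifs
    exacts [le_two_mul_realTermNeg _ _, Nat.le_succ _]
  have heq {m : ι} (hm : o m + o (σ m) = K m) :
      (a m).re = 0 ∧ 0 ≤ ε * (poleWeight a q m).re := by
    rw [ho] at hm
    split_ifs at hm with hre
    exacts [⟨hre, nonneg_of_two_mul_realTermNeg_eq hm⟩, absurd hm (Nat.succ_ne_self _)]
  rw [h.hankelForm_mulBy_blaschke_self hσ hle fun m hm =>
    (hσ.reflection_eq_self_iff h.injective).2 (heq hm).1, Complex.re_sum, Finset.mul_sum]
  refine Finset.sum_nonneg fun m hm => ?_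
  rw [Complex.re_mul_ofReal, ← mul_assoc]
  exact mul_nonneg (heq (Finset.mem_filter.1 hm).2).2 (by positivity)

variable {H : hardyPlus →L[ℂ] hardyPlus} (hH : IsHankelWithSymbol φ H)
  (hsa : (H : hardyPlus →ₗ[ℂ] hardyPlus).IsSymmetric)

include hH

theorem length_quotient_ker :
    Module.length ℂ (hardyPlus ⧸ LinearMap.ker (H : hardyPlus →ₗ[ℂ] hardyPlus)) =
      (∑ m, (K m + 1) : ℕ) := by
  classical
  rw [hH.ker_eq, h.ker_hankelForm, length_quotient_range_mulBy_blaschke h.im_pos]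
  rfl

include hsa

theorem poleWeight_im_eq_zero_of_re {m : ι} (hm : (a m).re = 0) : (poleWeight a q m).im = 0 := by
  classical
  obtain ⟨σ, hσ⟩ := h.exists_isPoleReflection (hH.hankelForm_reflect_eq_conj hsa)
  exact h.poleWeight_im_eq_zero (hH.hankelForm_reflect_eq_conj hsa) hσ
    ((hσ.reflection_eq_self_iff h.injective).2 hm)

theorem numEigenvalues_eq :
    numPosEigenvalues (H : hardyPlus →ₗ[ℂ] hardyPlus) =
        (∑ m with (a m).re = 0, realTermPos (K m) (poleWeight a q m).re +
          ∑ m with (a m).re < 0, (K m + 1) : ℕ) ∧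
      numNegEigenvalues (H : hardyPlus →ₗ[ℂ] hardyPlus) =
        (∑ m with (a m).re = 0, realTermNeg (K m) (poleWeight a q m).re +
          ∑ m with (a m).re < 0, (K m + 1) : ℕ) := by
  classical
  obtain ⟨σ, hσ⟩ := h.exists_isPoleReflection (hH.hankelForm_reflect_eq_conj hsa)
  have hne {m : ι} (hm : (a m).re = 0) : (poleWeight a q m).re ≠ 0 := fun h0 =>
    h.poleWeight_ne_zero m (Complex.ext h0 (h.poleWeight_im_eq_zero_of_re hH hsa hm))
  have hsemi (ε : ℝ) := fun w => h.hankelForm_semidefinite hH.symbol_bounded hσ ε (w := w)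
  have hneg := hsemi (-1)
  have hpos := hsemi 1
  simp only [neg_one_mul, one_mul, realTermNeg_neg, neg_nonneg, ← hH.inner_eq] at hneg hpos
  simp only [← sum_vanishingOrder]
  refine numEigenvalues_eq_of_semidefinite hsa hneg
    (length_quotient_range_mulBy_blaschke h.im_pos _) hpos
    (length_quotient_range_mulBy_blaschke h.im_pos _) ?_
  rw [h.length_quotient_ker hH, hσ.sum_vanishingOrder_add_sum_vanishingOrder h.injective
    fun m hm => realTermPos_add_realTermNeg _ (hne hm)]

end IsPolarSymbol

section RationalSymbol

/-- The multiplier `(-i)^(K+1) Q(-z) / (z + i)^K`, for `deg Q ≤ K`; it is the numerator of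
`Q(-z) (α + iz)^(-K-1)` with respect to the denominator in `IsPolarSymbol` at `a = iα`. -/
noncomputable def poleNumerator (K : ℕ) (Q : ℂ[X]) : multiplierAlgebra :=
  ∑ j ∈ Finset.range (K + 1),
    ((-I) ^ (K + 1) * (Q.coeff j * (-1) ^ j)) • (mobius 0 ^ j * invAddI ^ (K - j))

theorem poleNumerator_apply {K : ℕ} {Q : ℂ[X]} (hQ : Q.natDegree ≤ K) {z : ℂ} (hz : 0 ≤ z.im) :
    poleNumerator K Q z = (-I) ^ (K + 1) * Q.eval (-z) / (z + I) ^ K := by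
  have hsum := map_sum ((Pi.evalAlgHom ℂ (fun _ : ℂ => ℂ) z).comp multiplierAlgebra.val)
    (fun j => ((-I) ^ (K + 1) * (Q.coeff j * (-1) ^ j)) • (mobius 0 ^ j * invAddI ^ (K - j)))
    (Finset.range (K + 1))
  refine hsum.trans ?_
  rw [Polynomial.eval_eq_sum_range' (Nat.lt_succ_of_le hQ), Finset.mul_sum, Finset.sum_div]
  refine Finset.sum_congr rfl fun j hj => ?_
  have hj : j + (K - j) = K := Nat.add_sub_cancel' (Finset.mem_range_succ_iff.1 hj)
  have happly : mobius 0 z ^ j * invAddI z ^ (K - j) = z ^ j / (z + I) ^ K := by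
    rw [mobius_apply 0 hz, invAddI_apply, sub_zero, div_pow, inv_pow, ← div_eq_mul_inv, div_div,
      ← pow_add, hj]
  simp only [map_smul, map_mul, map_pow, smul_eq_mul]
  refine (congrArg (_ * ·) happly).trans ?_
  rw [neg_pow z]
  ring

theorem eval_neg_div_pow {α : ℂ} (hα : 0 < α.re) {K : ℕ} {Q : ℂ[X]} (hQ : Q.natDegree ≤ K)
    (x : ℝ) : Q.eval (-x : ℂ) / (α - I * (-x : ℂ)) ^ (K + 1) =
      poleNumerator K Q x / (mobius (I * α) x ^ K * (x - I * α)) := by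
  have hx : (x : ℂ) - I * α ≠ 0 := ofReal_sub_ne_zero (by simpa using hα.ne') x
  have hxI : (x : ℂ) + I ≠ 0 := add_I_ne_zero (by simp)
  have hden : α - I * (-x : ℂ) = I * (x - I * α) := by linear_combination α * Complex.I_sq
  rw [poleNumerator_apply hQ (by simp), mobius_apply _ (by simp), hden, mul_pow, ← Complex.inv_I,
    inv_pow, div_pow, pow_succ ((x : ℂ) - I * α)]
  field_simp

theorem poleWeight_poleNumerator {ι : Type*} {α : ι → ℂ} {K : ι → ℕ} {Q : ι → ℂ[X]} {m : ι}
    (hα : 0 < (α m).re) (hQ : (Q m).natDegree ≤ K m) :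
    poleWeight (fun m => I * α m) (fun m => poleNumerator (K m) (Q m)) m =
      2 * Real.pi * (-1) ^ K m / (α m + 1) ^ K m * (Q m).eval (-I * α m) := by
  rw [poleWeight, poleNumerator_apply hQ (by simpa using hα.le)]
  have hden : I * α m + I = I * (α m + 1) := by ring
  have hα1 : α m + 1 ≠ 0 := fun h => by
    have := congrArg Complex.re h
    simp at this
    linarith
  rw [hden, mul_pow, neg_pow, pow_succ, pow_succ]
  field_simp
  rw [Complex.I_sq]
  ring

theorem isPolarSymbol_rationalSymbol {M : ℕ} {α : Fin M → ℂ} {K : Fin M → ℕ} {Q : Fin M → ℂ[X]}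
    (hα : ∀ m, 0 < (α m).re) (hαinj : Function.Injective α)
    (hdeg : ∀ m, (Q m).natDegree ≤ K m) (hQ : ∀ m, (Q m).eval (-I * α m) ≠ 0) :
    IsPolarSymbol (rationalSymbol α K Q) (fun m => I * α m) K
      (fun m => poleNumerator (K m) (Q m)) where
  im_pos m := by simpa using hα m
  injective := (mul_right_injective₀ Complex.I_ne_zero).comp hαinj
  ne_zero m := by
    have him : 0 ≤ (I * α m).im := by simpa using (hα m).le
    rw [poleNumerator_apply (hdeg m) him, ← neg_mul]
    exact div_ne_zero (mul_ne_zero (pow_ne_zero _ (neg_ne_zero.2 Complex.I_ne_zero)) (hQ m))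
      (pow_ne_zero _ (add_I_ne_zero him))
  symbol_neg x := by
    rw [rationalSymbol]
    push_cast
    exact Finset.sum_congr rfl fun m _ => eval_neg_div_pow (hα m) (hdeg m) x

theorem exists_poleWeight_eq_mul {ι : Type*} {α : ι → ℂ} {K : ι → ℕ} {Q : ι → ℂ[X]} {m : ι}
    (hα : 0 < (α m).re) (him : (α m).im = 0) (hQ : (Q m).natDegree ≤ K m) :
    ∃ t : ℝ, t ≠ 0 ∧ (Even (K m) → 0 < t) ∧
      poleWeight (fun m => I * α m) (fun m => poleNumerator (K m) (Q m)) m =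
        t * (Q m).eval (-I * α m) := by
  have hre : α m = (α m).re := Complex.ext rfl (by simpa using him)
  refine ⟨2 * Real.pi * (-1) ^ K m / ((α m).re + 1) ^ K m, by positivity,
    fun hK => by rw [hK.neg_one_pow]; positivity, ?_⟩
  rw [poleWeight_poleNumerator hα hQ, hre]
  simp

theorem poleWeight_im_eq_zero_iff {ι : Type*} {α : ι → ℂ} {K : ι → ℕ} {Q : ι → ℂ[X]} {m : ι}
    (hα : 0 < (α m).re) (him : (α m).im = 0) (hQ : (Q m).natDegree ≤ K m) :
    (poleWeight (fun m => I * α m) (fun m => poleNumerator (K m) (Q m)) m).im = 0 ↔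
      ((Q m).eval (-I * α m)).im = 0 := by
  obtain ⟨t, ht, -, hweight⟩ := exists_poleWeight_eq_mul hα him hQ
  rw [hweight, Complex.im_ofReal_mul, mul_eq_zero, or_iff_right ht]

theorem realTerm_poleWeight {ι : Type*} {α : ι → ℂ} {K : ι → ℕ} {Q : ι → ℂ[X]} {m : ι}
    (hα : 0 < (α m).re) (him : (α m).im = 0) (hQ : (Q m).natDegree ≤ K m) :
    realTermPos (K m)
        (poleWeight (fun m => I * α m) (fun m => poleNumerator (K m) (Q m)) m).re =
          realTermPos (K m) ((Q m).eval (-I * α m)).re ∧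
      realTermNeg (K m)
        (poleWeight (fun m => I * α m) (fun m => poleNumerator (K m) (Q m)) m).re =
          realTermNeg (K m) ((Q m).eval (-I * α m)).re := by
  obtain ⟨t, -, ht, hweight⟩ := exists_poleWeight_eq_mul hα him hQ
  rw [hweight, Complex.re_ofReal_mul]
  exact realTerm_mul ht _

end RationalSymbol

theorem theorem5p1 {M : ℕ} (α : Fin M → ℂ) (K : Fin M → ℕ) (Q : Fin M → ℂ[X])
    (hα : ∀ m, 0 < (α m).re) (hαinj : Function.Injective α)
    (hdeg : ∀ m, (Q m).natDegree ≤ K m)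
    (hQ : ∀ m, (Q m).eval (-Complex.I * α m) ≠ 0)
    (H : hardyPlus →L[ℂ] hardyPlus)
    (hH : IsHankelWithSymbol (rationalSymbol α K Q) H)
    (hsa : (H : hardyPlus →ₗ[ℂ] hardyPlus).IsSymmetric) :
    (∀ m, (α m).im = 0 → ((Q m).eval (-Complex.I * α m)).im = 0) ∧
    numPosEigenvalues (H : hardyPlus →ₗ[ℂ] hardyPlus) =
      (((∑ m with (α m).im = 0, realTermPos (K m) ((Q m).eval (-Complex.I * α m)).re)
        + (∑ m with 0 < (α m).im, K m)
        + (Finset.univ.filter (fun m => 0 < (α m).im)).card : ℕ) : ℕ∞) ∧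
    numNegEigenvalues (H : hardyPlus →ₗ[ℂ] hardyPlus) =
      (((∑ m with (α m).im = 0, realTermNeg (K m) ((Q m).eval (-Complex.I * α m)).re)
        + (∑ m with 0 < (α m).im, K m)
        + (Finset.univ.filter (fun m => 0 < (α m).im)).card : ℕ) : ℕ∞) := by
  have hpolar := isPolarSymbol_rationalSymbol hα hαinj hdeg hQ
  have hre (m : Fin M) : (I * α m).re = -(α m).im := by simp
  have hterm (m : Fin M) (hm : m ∈ ({m | (α m).im = 0} : Finset (Fin M))) :=
    realTerm_poleWeight (hα m) (Finset.mem_filter.1 hm).2 (hdeg m)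
  have hcount := hpolar.numEigenvalues_eq hH hsa
  simp only [hre, neg_eq_zero, neg_lt_zero, Finset.sum_add_distrib, Finset.sum_const, smul_eq_mul,
    mul_one, Finset.sum_congr rfl fun m hm => (hterm m hm).1,
    Finset.sum_congr rfl fun m hm => (hterm m hm).2, ← add_assoc] at hcount
  refine ⟨fun m hm => (poleWeight_im_eq_zero_iff (hα m) hm (hdeg m)).1 ?_, hcount⟩
  exact hpolar.poleWeight_im_eq_zero_of_re hH hsa (by rw [hre, hm, neg_zero])
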